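/- \textbf{Theorem (number of representatives).} Write ${\bf f}=(m,n,k)$ for the form $mx^2+ny^2+kxy$, and let $C(m,n,k)$ be the class of an integer form, i.e. the set of all $f\circ M$ with $M\in \mathrm{SL}(2,\mathbb Z)$. Let $(m,n,k)\in\mathbb Z^3$ be such that $\Delta=k^2-4mn>0$ is not a perfect square. \emph{Period.} Let $\xi^+=\frac{-k+\sqrt{\Delta}}{2m}$ (the continued fraction of a negative number being $-[\alpha_0,\alpha_1,\dots]$, where $[\alpha_0,\alpha_1,\dots]$ is that of its absolute value). The continued fraction of $\xi^+$ is periodic; let $\Gamma=[a_1,\dots,a_P]$ be its period (minimal, i.e. not a repetition of a shorter sequence, and read from any of its cyclic starting points). Put $\Pi=[a_1,\dots,a_p]:=\Gamma$ if $P$ is even, and $\Pi=[a_1,\dots,a_p]:=\Gamma^2=[a_1,\dots,a_P,a_1,\dots,a_P]$ if $P$ is odd. Let $$t_{odd}=\sum_{i\ \mathrm{odd}}a_i,\qquad t_{even}=\sum_{i\ \mathrm{even}}a_i,\qquad t=\sum_{i=1}^p a_i .$$ \emph{Domains.} On the hyperboloid $H_\Delta=\{(m,n,k)\in\mathbb R^3: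 k^2-4mn=\Delta\}$ let $H^0=\{m>0,\,n<0\}$, $H^0_R=\{m<0,\,n>0\}$, $H_A=\{m,n,k>0,\ m+n<k\}$, $H_{\bar A}=\{m,n>0>k,\ m+n<-k\}$, $H_B=\{m,n,k<0,\ m+n>k\}$, $H_{\bar B}=\{m,n<0<k,\ m+n>-k\}$. Let $A:f(x,y)\mapsto f(x+y,y)$ and $B:f(x,y)\mapsto f(x,x+y)$, and let $\mathcal T^+$, $\mathcal T^-$ be the monoids of operators generated by $A,B$ and by $A^{-1},B^{-1}$ respectively. The domains of $G_A$ (resp. $G_B$) are the sets $T(H_A)$ (resp. $T(H_B)$) with $T\in\mathcal T^+$, and the domains of $G_{\bar A}$ (resp. $G_{\bar B}$) are the sets $T(H_{\bar A})$ (resp. $T(H_{\bar B})$) with $T\in\mathcal T^-$. \emph{Conclusion.} The class $C(m,n,k)$ has exactly $t$ points in $H^0$ and exactly $t$ points in $H^0_R$. It has exactly $t_{odd}$ points in every domain of $G_A$ and of $G_{\bar A}$ and exactly $t_{even}$ points in every domain of $G_B$ and of $G_{\bar B}$, or vice versa ($t_{even}$ in every domain of $G_A$, $G_{\bar A}$ and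 $t_{odd}$ in every domain of $G_B$, $G_{\bar B}$). Moreover $t_{odd}=t_{even}=t/2$ if $P$ is odd, or if $P$ is even and $\Gamma$ is palindromic (some cyclic permutation of $\Gamma$ reads the same backwards). Likewise $t_{odd}=t_{even}=t/2$ if the class $C(m,n,k)$ is supersymmetric (invariant under conjugation $(m,n,k)\mapsto(m,n,-k)$, the adjoint involution $(m,n,k)\mapsto(-n,-m,k)$ and the antipodal involution $(m,n,k)\mapsto(-n,-m,-k)$), antisymmetric (invariant under the antipodal involution but not under the other two), or $(m+n)$-symmetric (invariant under the adjoint involution but not under the other two). -/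

import Mathlib

/-- The binary quadratic form `m x² + n y² + k x y`, given by its triple of coefficients. -/
@[ext]
structure BinForm (R : Type*) where
  m : R
  n : R
  k : R

namespace BinForm

/-- The value `m x² + n y² + k x y`. -/
def eval {R : Type*} [CommRing R] (f : BinForm R) (x y : R) : R :=
  f.m * x ^ 2 + f.n * y ^ 2 + f.k * x * y

/-- The discriminant `k² - 4 m n`. -/
def disc {R : Type*} [CommRing R] (f : BinForm R) : R :=
  f.k ^ 2 - 4 * f.m * f.n

/-- The form `(x, y) ↦ f (M (x, y))`, for `M` in `SL(2, ℤ)`. -/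
def act {R : Type*} [CommRing R] (M : Matrix.SpecialLinearGroup (Fin 2) ℤ) (f : BinForm R) :
    BinForm R where
  m := f.m * (M 0 0 : ℤ) ^ 2 + f.n * (M 1 0 : ℤ) ^ 2 + f.k * (M 0 0 : ℤ) * (M 1 0 : ℤ)
  n := f.m * (M 0 1 : ℤ) ^ 2 + f.n * (M 1 1 : ℤ) ^ 2 + f.k * (M 0 1 : ℤ) * (M 1 1 : ℤ)
  k := 2 * f.m * (M 0 0 : ℤ) * (M 0 1 : ℤ) + 2 * f.n * (M 1 0 : ℤ) * (M 1 1 : ℤ)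
    + f.k * ((M 0 0 : ℤ) * (M 1 1 : ℤ) + (M 0 1 : ℤ) * (M 1 0 : ℤ))

theorem eval_act {R : Type*} [CommRing R] (M : Matrix.SpecialLinearGroup (Fin 2) ℤ)
    (f : BinForm R) (x y : R) :
    (f.act M).eval x y =
      f.eval ((M 0 0 : ℤ) * x + (M 0 1 : ℤ) * y) ((M 1 0 : ℤ) * x + (M 1 1 : ℤ) * y) := by
  simp only [eval, act]
  ring

/-- The class `C(m, n, k)` of an integer form under `SL(2, ℤ)`. -/
def cls (f : BinForm ℤ) : Set (BinForm ℤ) :=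
  {g | ∃ M : Matrix.SpecialLinearGroup (Fin 2) ℤ, g = f.act M}

/-- An integer form as a point of the space of real forms. -/
def toReal (f : BinForm ℤ) : BinForm ℝ := ⟨f.m, f.n, f.k⟩

/-! ### Involutions and symmetry types of classes -/

/-- The conjugate form `(m, n, -k)`. -/
def conjugate (f : BinForm ℤ) : BinForm ℤ := ⟨f.m, f.n, -f.k⟩

/-- The adjoint form `(-n, -m, k)`. -/
def adjoint (f : BinForm ℤ) : BinForm ℤ := ⟨-f.n, -f.m, f.k⟩

/-- The antipodal form `(-n, -m, -k)`. -/
def antipodal (f : BinForm ℤ) : BinForm ℤ := ⟨-f.n, -f.m, -f.k⟩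

/-- The set `C` of forms is mapped to itself by `φ`. -/
def InvariantUnder (φ : BinForm ℤ → BinForm ℤ) (C : Set (BinForm ℤ)) : Prop :=
  ∀ g ∈ C, φ g ∈ C

/-- Symmetry under conjugate, adjoint and antipodal involutions. -/
def IsSupersymmetric (C : Set (BinForm ℤ)) : Prop :=
  InvariantUnder conjugate C ∧ InvariantUnder adjoint C ∧ InvariantUnder antipodal C

/-- Symmetry under the antipodal involution only. -/
def IsAntisymmetric (C : Set (BinForm ℤ)) : Prop :=
  ¬ InvariantUnder conjugate C ∧ ¬ InvariantUnder adjoint C ∧ InvariantUnder antipodal C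

/-- `(m+n)`-symmetry: symmetry under the adjoint involution only. -/
def IsMNSymmetric (C : Set (BinForm ℤ)) : Prop :=
  ¬ InvariantUnder conjugate C ∧ InvariantUnder adjoint C ∧ ¬ InvariantUnder antipodal C

/-! ### Domains of the hyperboloid of real forms of discriminant `Δ` -/

/-- The hyperboloid `H_Δ` of real forms of discriminant `Δ`. -/
def hyperboloid (Δ : ℝ) : Set (BinForm ℝ) := {f | f.disc = Δ}

/-- The domain `H⁰`. -/
def H0 (Δ : ℝ) : Set (BinForm ℝ) := {f ∈ hyperboloid Δ | 0 < f.m ∧ f.n < 0}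

/-- The domain `H⁰_R`. -/
def H0R (Δ : ℝ) : Set (BinForm ℝ) := {f ∈ hyperboloid Δ | f.m < 0 ∧ 0 < f.n}

/-- The domain `H_A`. -/
def HA (Δ : ℝ) : Set (BinForm ℝ) :=
  {f ∈ hyperboloid Δ | 0 < f.m ∧ 0 < f.n ∧ 0 < f.k ∧ f.m + f.n < f.k}

/-- The domain `H_Ā`. -/
def HAbar (Δ : ℝ) : Set (BinForm ℝ) :=
  {f ∈ hyperboloid Δ | 0 < f.m ∧ 0 < f.n ∧ f.k < 0 ∧ f.m + f.n < -f.k}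

/-- The domain `H_B`. -/
def HB (Δ : ℝ) : Set (BinForm ℝ) :=
  {f ∈ hyperboloid Δ | f.m < 0 ∧ f.n < 0 ∧ f.k < 0 ∧ f.k < f.m + f.n}

/-- The domain `H_B̄`. -/
def HBbar (Δ : ℝ) : Set (BinForm ℝ) :=
  {f ∈ hyperboloid Δ | f.m < 0 ∧ f.n < 0 ∧ 0 < f.k ∧ -f.k < f.m + f.n}

/-- The generator `A`, acting on forms by `f (x + y, y)`. -/
def matA : Matrix.SpecialLinearGroup (Fin 2) ℤ :=
  ⟨!![1, 1; 0, 1], by simp [Matrix.det_fin_two]⟩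

/-- The generator `B`, acting on forms by `f (x, x + y)`. -/
def matB : Matrix.SpecialLinearGroup (Fin 2) ℤ :=
  ⟨!![1, 0; 1, 1], by simp [Matrix.det_fin_two]⟩

/-- The monoid `𝒯⁺` generated by `A` and `B`. -/
def Tplus : Submonoid (Matrix.SpecialLinearGroup (Fin 2) ℤ) :=
  Submonoid.closure {matA, matB}

/-- The monoid `𝒯⁻` generated by `A⁻¹` and `B⁻¹`. -/
def Tminus : Submonoid (Matrix.SpecialLinearGroup (Fin 2) ℤ) :=
  Submonoid.closure {matA⁻¹, matB⁻¹}

/-- The family `G_A` of the images of `H_A` under `𝒯⁺`. -/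
def GA (Δ : ℝ) : Set (Set (BinForm ℝ)) := {D | ∃ M ∈ Tplus, D = act M '' HA Δ}

/-- The family `G_B` of the images of `H_B` under `𝒯⁺`. -/
def GB (Δ : ℝ) : Set (Set (BinForm ℝ)) := {D | ∃ M ∈ Tplus, D = act M '' HB Δ}

/-- The family `G_Ā` of the images of `H_Ā` under `𝒯⁻`. -/
def GAbar (Δ : ℝ) : Set (Set (BinForm ℝ)) := {D | ∃ M ∈ Tminus, D = act M '' HAbar Δ}

/-- The family `G_B̄` of the images of `H_B̄` under `𝒯⁻`. -/
def GBbar (Δ : ℝ) : Set (Set (BinForm ℝ)) := {D | ∃ M ∈ Tminus, D = act M '' HBbar Δ}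

/-- The number of points of the class of `f` in the domain `D` (`⊤` if there are infinitely
many). -/
noncomputable def numPoints (f : BinForm ℤ) (D : Set (BinForm ℝ)) : ℕ∞ :=
  {g ∈ f.cls | g.toReal ∈ D}.encard

/-- The first root `ξ⁺ = (-k + √(k² - 4 m n)) / (2 m)`. -/
noncomputable def xiPlus (f : BinForm ℤ) : ℝ :=
  (-(f.k : ℝ) + Real.sqrt (f.disc : ℝ)) / (2 * (f.m : ℝ))

end BinForm

/-! ### Periods of continued fractions -/

/-- The element `α_i` of the regular continued fraction `x = [α_0, α_1, …]`
(`none` if the continued fraction has stopped before). -/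
noncomputable def cfElem (x : ℝ) : ℕ → Option ℝ
  | 0 => some (GenContFract.of x).h
  | i + 1 => (GenContFract.of x).partDens.get? i

/-- `l` cannot be written as a sequence of (at least two) identical sub-sequences. -/
def IsPrimitiveList (l : List ℕ) : Prop :=
  ¬ ∃ (b : List ℕ) (r : ℕ), 2 ≤ r ∧ l = (List.replicate r b).flatten

/-- `l` is the period of the continued fraction of the real number `x`, written from any of its
cyclic starting points. The continued fraction of a negative number `x` is taken to be
`-[α_0, α_1, …]` where `|x| = [α_0, α_1, …]`. -/
def IsPeriodOf (l : List ℕ) (x : ℝ) : Prop :=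
  l ≠ [] ∧ IsPrimitiveList l ∧
    ∃ N : ℕ, ∀ j : ℕ, cfElem |x| (N + j) = (l[j % l.length]?).map (fun a : ℕ => (a : ℝ))

/-- Some cyclic permutation of `l` reads the same backwards. -/
def IsCyclicPalindrome (l : List ℕ) : Prop :=
  ∃ l' : List ℕ, l'.IsRotated l ∧ l'.reverse = l'

/-- `Π`: the list `Γ` if its length is even, and `Γ` repeated twice if its length is odd. -/
def evenPeriod (Γ : List ℕ) : List ℕ :=
  if Odd Γ.length then Γ ++ Γ else Γ

/-- The sum of the elements `a_i` of `[a_1, …, a_p]` with `i` odd. -/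
def sumOdd (l : List ℕ) : ℕ :=
  ∑ i : Fin l.length, if Odd ((i : ℕ) + 1) then l.get i else 0

/-- The sum of the elements `a_i` of `[a_1, …, a_p]` with `i` even. -/
def sumEven (l : List ℕ) : ℕ :=
  ∑ i : Fin l.length, if Even ((i : ℕ) + 1) then l.get i else 0

namespace BinForm

/-! ### The action of `SL(2, ℤ)` on forms and on classes -/

/-! Call a form reduced when m > 0 > n, and let `step` apply A if ξ⁺ > 1 and B otherwise. On roots
this is the subtractive continued fraction algorithm, x ↦ x - 1 or x ↦ x / (1 - x)
(`xiPlus_iterate_step`), and the partial quotients are the lengths of the successive runs of A-steps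
and B-steps (`subtractiveStep_iterate_quotSum_add`). The whole count is a count of reduced forms of
the class along one cycle of `step`.

Since a class is stable under SL(2, ℤ), every domain of `GA` and `GAbar` contains as many of its
points as `HA`, and similarly for `GB`, `GBbar` and `HB`. B carries the reduced forms with ξ⁺ > 1
onto the points of `HB`, and A carries those with ξ⁺ < 1 onto the points of `HA` (`numPoints_HB_eq`,
`numPoints_HA_eq`). So `HB` counts A-steps, `HA` counts B-steps, and `H0` counts both.

There is only one cycle. A matrix joining two reduced forms is, up to sign and inversion,
nonnegative (`IsReduced.nonneg_or_inv_nonneg`); a nonnegative matrix is a product of A's and B's,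
and reducedness of the target forces each factor to be the one chosen by `step`
(`IsReduced.exists_iterate_step_of_nonneg`). A form with ξ⁺ > 0 enters the cycle because |k| drops
as long as reduction fails (`exists_iterate_step_isReduced`).

A form is determined by its discriminant and ξ⁺, so the cycle closes when the subtractive orbit
does. This takes an even number of partial quotients, since A-runs and B-runs alternate; primitivity
of Γ makes Π the shortest such block (`IsPrimitiveList.length_dvd`). Summing run lengths by parity
gives the numbers of points. Negative ξ⁺ is reduced to positive by f ↦ -f(x, -y), which exchanges
the roles of A and B. The symmetric cases follow from involutions exchanging the two kinds of
domains. -/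

theorem act_one {R : Type*} [CommRing R] (f : BinForm R) : f.act 1 = f := by
  ext <;> simp [act]

theorem act_act {R : Type*} [CommRing R] (M N : Matrix.SpecialLinearGroup (Fin 2) ℤ)
    (f : BinForm R) : (f.act M).act N = f.act (M * N) := by
  ext <;> simp [act, Matrix.mul_apply, Fin.sum_univ_two] <;> ring

theorem act_inv_act {R : Type*} [CommRing R] (M : Matrix.SpecialLinearGroup (Fin 2) ℤ)
    (f : BinForm R) : (f.act M⁻¹).act M = f := by
  rw [act_act, inv_mul_cancel, act_one]

theorem act_act_inv {R : Type*} [CommRing R] (M : Matrix.SpecialLinearGroup (Fin 2) ℤ)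
    (f : BinForm R) : (f.act M).act M⁻¹ = f := by
  rw [act_act, mul_inv_cancel, act_one]

theorem act_injective {R : Type*} [CommRing R] (M : Matrix.SpecialLinearGroup (Fin 2) ℤ) :
    Function.Injective (act M : BinForm R → BinForm R) :=
  Function.LeftInverse.injective (act_act_inv M)

theorem disc_act {R : Type*} [CommRing R] (M : Matrix.SpecialLinearGroup (Fin 2) ℤ)
    (f : BinForm R) : (f.act M).disc = f.disc := by
  have h : ((M 0 0 : ℤ) : R) * (M 1 1 : ℤ) - (M 0 1 : ℤ) * (M 1 0 : ℤ) = 1 := by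
    have := M.det_coe
    rw [Matrix.det_fin_two] at this
    rw [← Int.cast_mul, ← Int.cast_mul, ← Int.cast_sub, this, Int.cast_one]
  have key : (f.act M).disc =
      f.disc * (((M 0 0 : ℤ) : R) * (M 1 1 : ℤ) - (M 0 1 : ℤ) * (M 1 0 : ℤ)) ^ 2 := by
    simp only [disc, act]
    ring
  rw [key, h]
  ring

theorem toReal_act (M : Matrix.SpecialLinearGroup (Fin 2) ℤ) (f : BinForm ℤ) :
    (f.act M).toReal = f.toReal.act M := by
  ext <;> simp [act, toReal]

theorem disc_toReal (f : BinForm ℤ) : f.toReal.disc = (f.disc : ℝ) := by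
  simp [disc, toReal]

theorem mem_cls_self (f : BinForm ℤ) : f ∈ f.cls := ⟨1, (act_one f).symm⟩

theorem act_mem_cls {f g : BinForm ℤ} (M : Matrix.SpecialLinearGroup (Fin 2) ℤ) (hg : g ∈ f.cls) :
    g.act M ∈ f.cls := by
  obtain ⟨N, rfl⟩ := hg
  exact ⟨N * M, act_act N M f⟩

theorem exists_act_of_mem_cls {f g h : BinForm ℤ} (hg : g ∈ f.cls) (hh : h ∈ f.cls) :
    ∃ M : Matrix.SpecialLinearGroup (Fin 2) ℤ, h = g.act M := by
  obtain ⟨M, rfl⟩ := hg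
  obtain ⟨N, rfl⟩ := hh
  exact ⟨M⁻¹ * N, by rw [act_act, mul_inv_cancel_left]⟩

theorem disc_of_mem_cls {f g : BinForm ℤ} (hg : g ∈ f.cls) : g.disc = f.disc := by
  obtain ⟨M, rfl⟩ := hg
  exact disc_act M f

/-- Both the class and membership in the domain are transported by the bijection `act M`. -/
theorem numPoints_act_image (f : BinForm ℤ) (M : Matrix.SpecialLinearGroup (Fin 2) ℤ)
    (D : Set (BinForm ℝ)) : f.numPoints (act M '' D) = f.numPoints D := by
  have : {g ∈ f.cls | g.toReal ∈ act M '' D} = act M '' {g ∈ f.cls | g.toReal ∈ D} := by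
    ext g
    constructor
    · rintro ⟨hg, u, hu, hug⟩
      refine ⟨g.act M⁻¹, ⟨act_mem_cls _ hg, ?_⟩, act_inv_act M g⟩
      rw [toReal_act, ← hug, act_act_inv]
      exact hu
    · rintro ⟨u, ⟨hu, huD⟩, rfl⟩
      exact ⟨act_mem_cls _ hu, u.toReal, huD, (toReal_act M u).symm⟩
  rw [numPoints, numPoints, this, (act_injective M).encard_image]

/-- An involution of forms carrying the points of one class in `D` onto the points
of another class in `E` shows that the numbers of points agree. -/
theorem numPoints_eq_of_involutive {f f' : BinForm ℤ} {D E : Set (BinForm ℝ)}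
    {φ : BinForm ℤ → BinForm ℤ} (hφ : Function.Involutive φ)
    (h1 : ∀ g ∈ f.cls, φ g ∈ f'.cls) (h2 : ∀ g ∈ f'.cls, φ g ∈ f.cls)
    (h3 : ∀ g, g.toReal ∈ D → (φ g).toReal ∈ E) (h4 : ∀ g, g.toReal ∈ E → (φ g).toReal ∈ D) :
    f.numPoints D = f'.numPoints E := by
  have : {g ∈ f'.cls | g.toReal ∈ E} = φ '' {g ∈ f.cls | g.toReal ∈ D} := by
    ext g
    constructor
    · rintro ⟨hg, hgE⟩
      exact ⟨φ g, ⟨h2 g hg, h4 g hgE⟩, hφ g⟩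
    · rintro ⟨u, ⟨hu, huD⟩, rfl⟩
      exact ⟨h1 u hu, h3 u huD⟩
  rw [numPoints, numPoints, this, hφ.injective.encard_image]

/-- The rotation `(x, y) ↦ (y, -x)`. -/
def matS : Matrix.SpecialLinearGroup (Fin 2) ℤ :=
  ⟨!![0, 1; -1, 0], by simp [Matrix.det_fin_two]⟩

theorem act_matS {R : Type*} [CommRing R] (f : BinForm R) : f.act matS = ⟨f.n, f.m, -f.k⟩ := by
  ext <;> simp [act, matS]

theorem act_matA {R : Type*} [CommRing R] (f : BinForm R) :
    f.act matA = ⟨f.m, f.m + f.n + f.k, f.k + 2 * f.m⟩ := by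
  ext <;> simp [act, matA]
  ring

theorem act_matB {R : Type*} [CommRing R] (f : BinForm R) :
    f.act matB = ⟨f.m + f.n + f.k, f.n, f.k + 2 * f.n⟩ := by
  ext <;> simp [act, matB]
  ring

theorem act_matA_inv {R : Type*} [CommRing R] (f : BinForm R) :
    f.act matA⁻¹ = ⟨f.m, f.m + f.n - f.k, f.k - 2 * f.m⟩ := by
  apply act_injective matA
  rw [act_inv_act, act_matA]
  ext <;> simp
  ring

theorem act_matB_inv {R : Type*} [CommRing R] (f : BinForm R) :
    f.act matB⁻¹ = ⟨f.m + f.n - f.k, f.n, f.k - 2 * f.n⟩ := by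
  apply act_injective matB
  rw [act_inv_act, act_matB]
  ext <;> simp
  ring

theorem act_matS_image_HA (Δ : ℝ) : act matS '' HA Δ = HAbar Δ := by
  ext g
  constructor
  · rintro ⟨u, ⟨hd, h1, h2, h3, h4⟩, rfl⟩
    refine ⟨(disc_act matS u).trans hd, ?_⟩
    rw [act_matS]
    refine ⟨h2, h1, ?_, ?_⟩ <;> simp only <;> linarith
  · rintro ⟨hd, h1, h2, h3, h4⟩
    refine ⟨⟨g.n, g.m, -g.k⟩, ⟨?_, h2, h1, ?_, ?_⟩, ?_⟩
    · rw [← act_matS]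
      exact (disc_act matS g).trans hd
    · simp only; linarith
    · simp only; linarith
    · rw [act_matS]; simp

theorem act_matS_image_HB (Δ : ℝ) : act matS '' HB Δ = HBbar Δ := by
  ext g
  constructor
  · rintro ⟨u, ⟨hd, h1, h2, h3, h4⟩, rfl⟩
    refine ⟨(disc_act matS u).trans hd, ?_⟩
    rw [act_matS]
    refine ⟨h2, h1, ?_, ?_⟩ <;> simp only <;> linarith
  · rintro ⟨hd, h1, h2, h3, h4⟩
    refine ⟨⟨g.n, g.m, -g.k⟩, ⟨?_, h2, h1, ?_, ?_⟩, ?_⟩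
    · rw [← act_matS]
      exact (disc_act matS g).trans hd
    · simp only; linarith
    · simp only; linarith
    · rw [act_matS]; simp

theorem act_matS_image_H0 (Δ : ℝ) : act matS '' H0 Δ = H0R Δ := by
  ext g
  constructor
  · rintro ⟨u, ⟨hd, h1, h2⟩, rfl⟩
    refine ⟨(disc_act matS u).trans hd, ?_⟩
    rw [act_matS]
    exact ⟨h2, h1⟩
  · rintro ⟨hd, h1, h2⟩
    refine ⟨⟨g.n, g.m, -g.k⟩, ⟨?_, h2, h1⟩, ?_⟩
    · rw [← act_matS]
      exact (disc_act matS g).trans hd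
    · rw [act_matS]; simp

theorem numPoints_HAbar (f : BinForm ℤ) (Δ : ℝ) : f.numPoints (HAbar Δ) = f.numPoints (HA Δ) := by
  rw [← act_matS_image_HA, numPoints_act_image]

theorem numPoints_HBbar (f : BinForm ℤ) (Δ : ℝ) : f.numPoints (HBbar Δ) = f.numPoints (HB Δ) := by
  rw [← act_matS_image_HB, numPoints_act_image]

theorem numPoints_H0R (f : BinForm ℤ) (Δ : ℝ) : f.numPoints (H0R Δ) = f.numPoints (H0 Δ) := by
  rw [← act_matS_image_H0, numPoints_act_image]

theorem numPoints_of_mem_GA {f : BinForm ℤ} {Δ : ℝ} {D : Set (BinForm ℝ)}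
    (hD : D ∈ GA Δ ∪ GAbar Δ) : f.numPoints D = f.numPoints (HA Δ) := by
  rcases hD with ⟨M, -, rfl⟩ | ⟨M, -, rfl⟩
  · exact numPoints_act_image f M _
  · rw [numPoints_act_image, numPoints_HAbar]

theorem numPoints_of_mem_GB {f : BinForm ℤ} {Δ : ℝ} {D : Set (BinForm ℝ)}
    (hD : D ∈ GB Δ ∪ GBbar Δ) : f.numPoints D = f.numPoints (HB Δ) := by
  rcases hD with ⟨M, -, rfl⟩ | ⟨M, -, rfl⟩
  · exact numPoints_act_image f M _
  · rw [numPoints_act_image, numPoints_HBbar]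

/-! ### Integer points of the domains -/

theorem toReal_mem_H0 {g : BinForm ℤ} {Δ : ℝ} :
    g.toReal ∈ H0 Δ ↔ (g.disc : ℝ) = Δ ∧ 0 < g.m ∧ g.n < 0 := by
  simp only [H0, hyperboloid, Set.mem_ofPred_eq, disc_toReal]
  simp only [toReal]
  norm_cast

theorem toReal_mem_H0R {g : BinForm ℤ} {Δ : ℝ} :
    g.toReal ∈ H0R Δ ↔ (g.disc : ℝ) = Δ ∧ g.m < 0 ∧ 0 < g.n := by
  simp only [H0R, hyperboloid, Set.mem_ofPred_eq, disc_toReal]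
  simp only [toReal]
  norm_cast

theorem toReal_mem_HA {g : BinForm ℤ} {Δ : ℝ} :
    g.toReal ∈ HA Δ ↔ (g.disc : ℝ) = Δ ∧ 0 < g.m ∧ 0 < g.n ∧ 0 < g.k ∧ g.m + g.n < g.k := by
  simp only [HA, hyperboloid, Set.mem_ofPred_eq, disc_toReal]
  simp only [toReal]
  norm_cast

theorem toReal_mem_HAbar {g : BinForm ℤ} {Δ : ℝ} :
    g.toReal ∈ HAbar Δ ↔ (g.disc : ℝ) = Δ ∧ 0 < g.m ∧ 0 < g.n ∧ g.k < 0 ∧ g.m + g.n < -g.k := by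
  simp only [HAbar, hyperboloid, Set.mem_ofPred_eq, disc_toReal]
  simp only [toReal]
  norm_cast

theorem toReal_mem_HB {g : BinForm ℤ} {Δ : ℝ} :
    g.toReal ∈ HB Δ ↔ (g.disc : ℝ) = Δ ∧ g.m < 0 ∧ g.n < 0 ∧ g.k < 0 ∧ g.k < g.m + g.n := by
  simp only [HB, hyperboloid, Set.mem_ofPred_eq, disc_toReal]
  simp only [toReal]
  norm_cast

theorem toReal_mem_HBbar {g : BinForm ℤ} {Δ : ℝ} :
    g.toReal ∈ HBbar Δ ↔ (g.disc : ℝ) = Δ ∧ g.m < 0 ∧ g.n < 0 ∧ 0 < g.k ∧ -g.k < g.m + g.n := by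
  simp only [HBbar, hyperboloid, Set.mem_ofPred_eq, disc_toReal]
  simp only [toReal]
  norm_cast

/-! ### Involutions -/

/-- The antipodal involution exchanges `HA` and `HB`. -/
theorem numPoints_HA_eq_HB_of_antipodal {f : BinForm ℤ} (h : InvariantUnder antipodal f.cls)
    (Δ : ℝ) : f.numPoints (HA Δ) = f.numPoints (HB Δ) := by
  refine numPoints_eq_of_involutive (φ := antipodal) (fun g => by simp [antipodal]) h h ?_ ?_
  · intro g
    rw [toReal_mem_HA, toReal_mem_HB]
    rintro ⟨hd, h1, h2, h3, h4⟩
    refine ⟨?_, ?_⟩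
    · rw [← hd, disc, disc, antipodal]; push_cast; ring
    · simp only [antipodal]; omega
  · intro g
    rw [toReal_mem_HA, toReal_mem_HB]
    rintro ⟨hd, h1, h2, h3, h4⟩
    refine ⟨?_, ?_⟩
    · rw [← hd, disc, disc, antipodal]; push_cast; ring
    · simp only [antipodal]; omega

/-- The adjoint involution exchanges `HA` with `HBbar`, which has as many points as `HB`. -/
theorem numPoints_HA_eq_HB_of_adjoint {f : BinForm ℤ} (h : InvariantUnder adjoint f.cls)
    (Δ : ℝ) : f.numPoints (HA Δ) = f.numPoints (HB Δ) := by
  rw [← numPoints_HBbar]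
  refine numPoints_eq_of_involutive (φ := adjoint) (fun g => by simp [adjoint]) h h ?_ ?_
  · intro g
    rw [toReal_mem_HA, toReal_mem_HBbar]
    rintro ⟨hd, h1, h2, h3, h4⟩
    refine ⟨?_, ?_⟩
    · rw [← hd, disc, disc, adjoint]; push_cast; ring
    · simp only [adjoint]; omega
  · intro g
    rw [toReal_mem_HA, toReal_mem_HBbar]
    rintro ⟨hd, h1, h2, h3, h4⟩
    refine ⟨?_, ?_⟩
    · rw [← hd, disc, disc, adjoint]; push_cast; ring
    · simp only [adjoint]; omega

/-- The form `-f (x, -y)`, whose roots are opposite to those of `f`. -/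
def negConj (f : BinForm ℤ) : BinForm ℤ := ⟨-f.m, -f.n, f.k⟩

theorem negConj_involutive : Function.Involutive negConj := fun g => by simp [negConj]

theorem disc_negConj (f : BinForm ℤ) : f.negConj.disc = f.disc := by
  simp [disc, negConj]

theorem negConj_mem_cls {f g : BinForm ℤ} (hg : g ∈ f.cls) : g.negConj ∈ f.negConj.cls := by
  obtain ⟨M, rfl⟩ := hg
  -- The matrix is M conjugated by diag(1, -1).
  refine ⟨⟨!![M 0 0, -M 0 1; -M 1 0, M 1 1], ?_⟩, ?_⟩
  · have := M.det_coe
    rw [Matrix.det_fin_two] at this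
    simpa [Matrix.det_fin_two] using this
  · ext <;> simp [act, negConj] <;> ring

theorem numPoints_negConj {f : BinForm ℤ} {D E : Set (BinForm ℝ)}
    (h1 : ∀ g : BinForm ℤ, g.toReal ∈ D → g.negConj.toReal ∈ E)
    (h2 : ∀ g : BinForm ℤ, g.toReal ∈ E → g.negConj.toReal ∈ D) :
    f.negConj.numPoints D = f.numPoints E := by
  refine numPoints_eq_of_involutive negConj_involutive (fun g hg => ?_)
    (fun g hg => negConj_mem_cls hg) h1 h2
  rw [← negConj_involutive f]
  exact negConj_mem_cls hg

theorem numPoints_negConj_HA (f : BinForm ℤ) (Δ : ℝ) :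
    f.negConj.numPoints (HA Δ) = f.numPoints (HB Δ) := by
  rw [← numPoints_HBbar]
  apply numPoints_negConj <;> intro g <;> rw [toReal_mem_HA, toReal_mem_HBbar, disc_negConj] <;>
    simp only [negConj] <;> rintro ⟨hd, h⟩ <;> exact ⟨hd, by omega⟩

theorem numPoints_negConj_HB (f : BinForm ℤ) (Δ : ℝ) :
    f.negConj.numPoints (HB Δ) = f.numPoints (HA Δ) := by
  rw [← numPoints_HAbar]
  apply numPoints_negConj <;> intro g <;> rw [toReal_mem_HB, toReal_mem_HAbar, disc_negConj] <;>
    simp only [negConj] <;> rintro ⟨hd, h⟩ <;> exact ⟨hd, by omega⟩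

theorem numPoints_negConj_H0 (f : BinForm ℤ) (Δ : ℝ) :
    f.negConj.numPoints (H0 Δ) = f.numPoints (H0 Δ) := by
  rw [← numPoints_H0R f]
  apply numPoints_negConj <;> intro g <;> rw [toReal_mem_H0, toReal_mem_H0R, disc_negConj] <;>
    simp only [negConj] <;> rintro ⟨hd, h⟩ <;> exact ⟨hd, by omega⟩

theorem xiPlus_negConj (f : BinForm ℤ) : f.negConj.xiPlus = -f.xiPlus := by
  rw [xiPlus, disc_negConj, xiPlus]
  simp only [negConj]
  push_cast
  rw [mul_neg, div_neg]

end BinForm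

/-! ### Complete quotients of continued fractions -/

/-- The complete quotient `x_j` of the continued fraction of `x`. -/
noncomputable def complQuot (x : ℝ) (j : ℕ) : ℝ := (fun y : ℝ => (Int.fract y)⁻¹)^[j] x

/-- The partial quotient `a_j` of the continued fraction of a positive number `x`. -/
noncomputable def partQuot (x : ℝ) (j : ℕ) : ℕ := ⌊complQuot x j⌋₊

/-- The sum `a_0 + ⋯ + a_{j-1}` of the first `j` partial quotients. -/
noncomputable def quotSum (x : ℝ) (j : ℕ) : ℕ := ∑ i ∈ Finset.range j, partQuot x i

theorem complQuot_zero (x : ℝ) : complQuot x 0 = x := rfl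

theorem complQuot_succ (x : ℝ) (j : ℕ) : complQuot x (j + 1) = (Int.fract (complQuot x j))⁻¹ :=
  Function.iterate_succ_apply' _ _ _

theorem complQuot_succ' (x : ℝ) (j : ℕ) : complQuot x (j + 1) = complQuot (Int.fract x)⁻¹ j :=
  Function.iterate_succ_apply _ _ _

theorem complQuot_add (x : ℝ) (i j : ℕ) : complQuot x (i + j) = complQuot (complQuot x i) j := by
  rw [add_comm]
  exact Function.iterate_add_apply _ _ _ _

theorem quotSum_succ (x : ℝ) (j : ℕ) : quotSum x (j + 1) = quotSum x j + partQuot x j :=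
  Finset.sum_range_succ _ _

theorem irrational_inv_fract {x : ℝ} (hx : Irrational x) : Irrational (Int.fract x)⁻¹ :=
  (hx.sub_intCast ⌊x⌋).inv

theorem fract_pos_of_irrational {x : ℝ} (hx : Irrational x) : 0 < Int.fract x :=
  Int.fract_pos.2 (hx.ne_int _)

theorem irrational_complQuot {x : ℝ} (hx : Irrational x) (j : ℕ) : Irrational (complQuot x j) := by
  induction j with
  | zero => exact hx
  | succ j ih =>
    rw [complQuot_succ]
    exact irrational_inv_fract ih

theorem one_lt_complQuot {x : ℝ} (hx : Irrational x) {j : ℕ} (hj : 1 ≤ j) :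
    1 < complQuot x j := by
  obtain ⟨j, rfl⟩ := Nat.exists_eq_add_of_le' hj
  rw [complQuot_succ]
  exact (one_lt_inv₀ (fract_pos_of_irrational (irrational_complQuot hx j))).2 (Int.fract_lt_one _)

theorem complQuot_pos {x : ℝ} (hx : Irrational x) (h0 : 0 < x) (j : ℕ) : 0 < complQuot x j := by
  rcases Nat.eq_zero_or_pos j with rfl | hj
  · exact h0
  · exact zero_lt_one.trans (one_lt_complQuot hx hj)

theorem partQuot_pos {x : ℝ} (hx : Irrational x) {j : ℕ} (hj : 1 ≤ j) : 0 < partQuot x j :=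
  Nat.floor_pos.2 (one_lt_complQuot hx hj).le

theorem get?_of_irrational {x : ℝ} (hx : Irrational x) (j : ℕ) :
    (GenContFract.of x).s.get? j = some ⟨1, (⌊complQuot x (j + 1)⌋ : ℝ)⟩ := by
  induction j generalizing x with
  | zero => exact GenContFract.of_s_head (fract_pos_of_irrational hx).ne'
  | succ j ih => rw [GenContFract.of_s_succ, ih (irrational_inv_fract hx), complQuot_succ' x]

theorem cfElem_eq_floor {x : ℝ} (hx : Irrational x) (j : ℕ) :
    cfElem x j = some (⌊complQuot x j⌋ : ℝ) := by
  cases j with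
  | zero => rfl
  | succ j =>
    rw [cfElem, GenContFract.partDens, Stream'.Seq.map_get?, get?_of_irrational hx]
    rfl

theorem cfElem_eq_partQuot {x : ℝ} (hx : Irrational x) (h0 : 0 < x) (j : ℕ) :
    cfElem x j = some (partQuot x j : ℝ) := by
  rw [cfElem_eq_floor hx, partQuot, natCast_floor_eq_intCast_floor (complQuot_pos hx h0 j).le]

/-- An irrational number is determined by its continued fraction. -/
theorem eq_of_floor_complQuot_eq {x y : ℝ} (hx : Irrational x) (hy : Irrational y)
    (h : ∀ j, ⌊complQuot x j⌋ = ⌊complQuot y j⌋) : x = y := by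
  have : GenContFract.of x = GenContFract.of y := by
    apply GenContFract.ext
    · rw [GenContFract.of_h_eq_floor, GenContFract.of_h_eq_floor]
      exact congrArg _ (h 0)
    · apply Stream'.Seq.ext
      intro j
      rw [get?_of_irrational hx, get?_of_irrational hy, h]
  have hc := GenContFract.of_convergence x
  rw [this] at hc
  exact tendsto_nhds_unique hc (GenContFract.of_convergence y)

theorem complQuot_eq_of_partQuot_eq {x : ℝ} (hx : Irrational x) (h0 : 0 < x) {M N : ℕ}
    (h : ∀ j, partQuot x (M + j) = partQuot x (N + j)) : complQuot x M = complQuot x N := by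
  refine eq_of_floor_complQuot_eq (irrational_complQuot hx M) (irrational_complQuot hx N) ?_
  intro j
  rw [← complQuot_add, ← complQuot_add, ← Int.natCast_floor_eq_floor (complQuot_pos hx h0 _).le,
    ← Int.natCast_floor_eq_floor (complQuot_pos hx h0 _).le]
  exact congrArg _ (h j)

/-! ### The subtractive algorithm -/

/-- One step of the subtractive form of the continued fraction algorithm. -/
noncomputable def subtractiveStep (x : ℝ) : ℝ := if 1 < x then x - 1 else x / (1 - x)

/-- Inversion swaps the two branches, so runs of the second branch are inverted runs of the first.
-/
theorem subtractiveStep_inv {x : ℝ} (h0 : 0 < x) (h1 : x ≠ 1) :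
    subtractiveStep x⁻¹ = (subtractiveStep x)⁻¹ := by
  rcases lt_or_gt_of_ne h1 with h | h
  · have h2 : 1 < x⁻¹ := (one_lt_inv₀ h0).2 h
    have h3 : 1 - x ≠ 0 := by linarith
    rw [subtractiveStep, if_pos h2, subtractiveStep, if_neg h.le.not_gt]
    field_simp
  · have h2 : ¬ 1 < x⁻¹ := ((inv_lt_one₀ h0).2 h).le.not_gt
    have h3 : x - 1 ≠ 0 := by linarith
    rw [subtractiveStep, if_neg h2, subtractiveStep, if_pos h]
    have h4 : 1 - x⁻¹ = (x - 1) / x := by field_simp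
    rw [h4]
    field_simp

theorem subtractiveStep_iterate {x : ℝ} (hx : Irrational x) (h0 : 0 < x) {i : ℕ}
    (hi : i ≤ ⌊x⌋₊) : subtractiveStep^[i] x = x - i := by
  induction i with
  | zero => simp
  | succ i ih =>
    have h : ((i + 1 : ℕ) : ℝ) < x :=
      lt_of_le_of_ne ((Nat.le_floor_iff h0.le).1 hi) (hx.ne_nat _).symm
    push_cast at h
    rw [Function.iterate_succ_apply', ih (by omega), subtractiveStep, if_pos (by linarith)]
    push_cast
    ring

theorem subtractiveStep_iterate_inv {x : ℝ} (hx : Irrational x) (h0 : 0 < x) {i : ℕ}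
    (hi : i ≤ ⌊x⌋₊) : subtractiveStep^[i] x⁻¹ = (x - i)⁻¹ := by
  induction i with
  | zero => simp
  | succ i ih =>
    have h : ((i + 1 : ℕ) : ℝ) < x :=
      lt_of_le_of_ne ((Nat.le_floor_iff h0.le).1 hi) (hx.ne_nat _).symm
    push_cast at h
    rw [Function.iterate_succ_apply', ih (by omega),
      subtractiveStep_inv (by linarith) (by linarith), subtractiveStep, if_pos (by linarith)]
    push_cast
    ring

/-- The a_j subtractions of block j leave the fractional part of the complete quotient, whose
inverse is the next one. The subtractive algorithm omits this inversion, hence the alternation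
between x_j and its inverse. -/
theorem subtractiveStep_iterate_quotSum {x : ℝ} (hx : Irrational x) (h0 : 0 < x) (j : ℕ) :
    subtractiveStep^[quotSum x j] x =
      if Even j then complQuot x j else (complQuot x j)⁻¹ := by
  induction j with
  | zero => simp [quotSum, complQuot_zero]
  | succ j ih =>
    have hf : complQuot x j - (partQuot x j : ℝ) = Int.fract (complQuot x j) := by
      rw [partQuot, natCast_floor_eq_intCast_floor (complQuot_pos hx h0 j).le]
      rfl
    rw [quotSum_succ, add_comm, Function.iterate_add_apply, ih, complQuot_succ]
    by_cases hj : Even j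
    · rw [if_pos hj, if_neg (by simpa [Nat.even_add_one] using hj),
        subtractiveStep_iterate (irrational_complQuot hx j) (complQuot_pos hx h0 j)
          (i := partQuot x j) le_rfl, inv_inv]
      exact hf
    · rw [if_neg hj, if_pos (by simpa [Nat.even_add_one] using hj),
        subtractiveStep_iterate_inv (irrational_complQuot hx j) (complQuot_pos hx h0 j)
          (i := partQuot x j) le_rfl]
      exact congrArg _ hf

theorem subtractiveStep_iterate_quotSum_add {x : ℝ} (hx : Irrational x) (h0 : 0 < x) {j i : ℕ}
    (hi : i ≤ partQuot x j) : subtractiveStep^[quotSum x j + i] x =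
      if Even j then complQuot x j - i else (complQuot x j - i)⁻¹ := by
  rw [add_comm, Function.iterate_add_apply, subtractiveStep_iterate_quotSum hx h0]
  split_ifs
  · exact subtractiveStep_iterate (irrational_complQuot hx j) (complQuot_pos hx h0 j) hi
  · exact subtractiveStep_iterate_inv (irrational_complQuot hx j) (complQuot_pos hx h0 j) hi

theorem one_lt_complQuot_sub {x : ℝ} (hx : Irrational x) (h0 : 0 < x) {j i : ℕ}
    (hi : i < partQuot x j) : 1 < complQuot x j - i := by
  have h : ((i + 1 : ℕ) : ℝ) < complQuot x j :=
    lt_of_le_of_ne ((Nat.le_floor_iff (complQuot_pos hx h0 j).le).1 hi)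
      ((irrational_complQuot hx j).ne_nat _).symm
  push_cast at h
  linarith

theorem one_lt_subtractiveStep_iterate_iff {x : ℝ} (hx : Irrational x) (h0 : 0 < x) {j i : ℕ}
    (hi : i < partQuot x j) : 1 < subtractiveStep^[quotSum x j + i] x ↔ Even j := by
  have h := one_lt_complQuot_sub hx h0 hi
  rw [subtractiveStep_iterate_quotSum_add hx h0 hi.le]
  split_ifs with hj
  · exact iff_of_true h hj
  · exact iff_of_false ((inv_lt_one₀ (by linarith)).2 h).le.not_gt hj

theorem quotSum_mono (x : ℝ) : Monotone (quotSum x) :=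
  monotone_nat_of_le_succ fun j => by rw [quotSum_succ]; omega

theorem quotSum_lt_succ {x : ℝ} (hx : Irrational x) {j : ℕ} (hj : 1 ≤ j) :
    quotSum x j < quotSum x (j + 1) := by
  have := partQuot_pos hx hj
  rw [quotSum_succ]
  omega

/-- The shift by one is needed because a_0 may be 0; all later partial quotients are at least 1. -/
theorem le_quotSum_succ {x : ℝ} (hx : Irrational x) (j : ℕ) : j ≤ quotSum x (j + 1) := by
  induction j with
  | zero => exact Nat.zero_le _
  | succ j ih => exact ih.trans_lt (quotSum_lt_succ hx (by omega))

/-- The weights c and d allow counting all steps, or only those of one kind, with a single formula.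
-/
theorem sum_Ico_quotSum {x : ℝ} (hx : Irrational x) (h0 : 0 < x) (c d N p : ℕ) :
    (∑ i ∈ Finset.Ico (quotSum x N) (quotSum x (N + p)),
        if 1 < subtractiveStep^[i] x then c else d) =
      ∑ j ∈ Finset.range p, if Even (N + j) then c * partQuot x (N + j)
        else d * partQuot x (N + j) := by
  induction p with
  | zero => simp
  | succ p ih =>
    rw [Finset.sum_range_succ, ← ih, ← add_assoc, ← Finset.sum_Ico_consecutive _
      (quotSum_mono x (Nat.le_add_right N p)) (quotSum_mono x (Nat.le_succ (N + p)))]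
    congr 1
    rw [Nat.succ_eq_add_one, quotSum_succ, Finset.sum_Ico_eq_sum_range, Nat.add_sub_cancel_left]
    have : ∀ i ∈ Finset.range (partQuot x (N + p)),
        (if 1 < subtractiveStep^[quotSum x (N + p) + i] x then c else d) =
          if Even (N + p) then c else d := by
      intro i hi
      simp only [one_lt_subtractiveStep_iterate_iff hx h0 (Finset.mem_range.1 hi)]
    rw [Finset.sum_congr rfl this, Finset.sum_const, Finset.card_range, smul_eq_mul]
    split_ifs <;> ring

/-- A recurrence of the subtractive algorithm comes from an even recurrence of complete
quotients. -/
theorem exists_even_of_subtractiveStep_iterate_eq {x : ℝ} (hx : Irrational x) (h0 : 0 < x)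
    {N T : ℕ} (hN : 1 ≤ N) (hT : 0 < T)
    (h : subtractiveStep^[quotSum x N + T] x = subtractiveStep^[quotSum x N] x) :
    ∃ q, Even q ∧ 0 < q ∧ quotSum x (N + 1 + q) = quotSum x (N + 1) + T ∧
      complQuot x (N + 1 + q) = complQuot x (N + 1) := by
  -- The block j containing the position of the recurrence is the first one ending beyond it.
  have hex : ∃ j, quotSum x N + T < quotSum x (j + 1) :=
    ⟨quotSum x N + T + 1, lt_of_lt_of_le (Nat.lt_succ_self _) (le_quotSum_succ hx _)⟩
  obtain ⟨j, hj, hmin⟩ : ∃ j, quotSum x N + T < quotSum x (j + 1) ∧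
      ∀ i < j, ¬ quotSum x N + T < quotSum x (i + 1) :=
    ⟨Nat.find hex, Nat.find_spec hex, fun i hi => Nat.find_min hex hi⟩
  have hNj : N ≤ j := by
    by_contra hlt
    have := quotSum_mono x (show j + 1 ≤ N by omega)
    omega
  have hle : quotSum x j ≤ quotSum x N + T := by
    have := hmin (j - 1) (by omega)
    rw [Nat.sub_add_cancel (by omega)] at this
    omega
  obtain ⟨r, hr⟩ := Nat.exists_eq_add_of_le hle
  have hrj : r < partQuot x j := by
    rw [quotSum_succ] at hj
    omega
  have h1 := one_lt_complQuot_sub hx h0 hrj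
  have h2 := one_lt_complQuot hx hN
  rw [hr, subtractiveStep_iterate_quotSum_add hx h0 hrj.le,
    subtractiveStep_iterate_quotSum hx h0] at h
  have h1' : (complQuot x j - r)⁻¹ < 1 := (inv_lt_one₀ (by linarith)).2 h1
  have h2' : (complQuot x N)⁻¹ < 1 := (inv_lt_one₀ (by linarith)).2 h2
  -- Even blocks give values above 1 and odd blocks values below 1, so equal values force equal
  -- parity.
  have hpar : (Even j ↔ Even N) ∧ complQuot x j - r = complQuot x N := by
    by_cases hj : Even j <;> by_cases hN : Even N <;> simp only [hj, hN, if_true, if_false] at h ⊢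
    · exact ⟨trivial, h⟩
    · linarith
    · linarith
    · exact ⟨trivial, inv_injective h⟩
  obtain ⟨hpar, heq⟩ := hpar
  have hj' : complQuot x j = complQuot x N + (r : ℕ) := by linarith
  have hfl : partQuot x j = partQuot x N + r := by
    rw [partQuot, hj', Nat.floor_add_natCast (by linarith)]
    rfl
  have hs : quotSum x (j + 1) = quotSum x (N + 1) + T := by
    rw [quotSum_succ, quotSum_succ]
    omega
  -- The two complete quotients differ by the integer r, so they agree from the next index on; this
  -- is why the recurrence is stated at N + 1.
  have hc : complQuot x (j + 1) = complQuot x (N + 1) := by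
    rw [complQuot_succ, complQuot_succ, hj', Int.fract_add_natCast]
  have hjN : j ≠ N := by
    rintro rfl
    omega
  refine ⟨j - N, ?_, by omega, ?_, ?_⟩
  · rw [Nat.even_sub hNj]
    exact hpar
  · rw [show N + 1 + (j - N) = j + 1 by omega, hs]
  · rw [show N + 1 + (j - N) = j + 1 by omega, hc]

theorem partQuot_add_of_complQuot_eq {x : ℝ} {M N : ℕ} (h : complQuot x M = complQuot x N)
    (j : ℕ) : partQuot x (M + j) = partQuot x (N + j) := by
  rw [partQuot, partQuot, complQuot_add, complQuot_add x N, h]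

/-! ### Periods as lists -/

theorem sumOdd_eq (l : List ℕ) :
    sumOdd l = ∑ i ∈ Finset.range l.length, if Even i then l.getD i 0 else 0 := by
  rw [sumOdd, Finset.sum_range]
  refine Finset.sum_congr rfl fun i _ => ?_
  simp [Nat.odd_add_one]

theorem sumEven_eq (l : List ℕ) :
    sumEven l = ∑ i ∈ Finset.range l.length, if Even i then 0 else l.getD i 0 := by
  rw [sumEven, Finset.sum_range]
  refine Finset.sum_congr rfl fun i _ => ?_
  simp [Nat.even_add_one, -Nat.not_even_iff_odd]

theorem sum_eq_sum_getD (l : List ℕ) : l.sum = ∑ i ∈ Finset.range l.length, l.getD i 0 := by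
  rw [Finset.sum_range, ← Fin.sum_univ_getElem]
  simp

theorem sumOdd_add_sumEven (l : List ℕ) : sumOdd l + sumEven l = l.sum := by
  rw [sumOdd_eq, sumEven_eq, sum_eq_sum_getD, ← Finset.sum_add_distrib]
  refine Finset.sum_congr rfl fun i _ => ?_
  split_ifs <;> simp

theorem sumOdd_cons (a : ℕ) (l : List ℕ) : sumOdd (a :: l) = a + sumEven l := by
  rw [sumOdd_eq, sumEven_eq, List.length_cons, Finset.sum_range_succ', add_comm]
  simp [Nat.even_add_one, -Nat.not_even_iff_odd]

theorem sumEven_cons (a : ℕ) (l : List ℕ) : sumEven (a :: l) = sumOdd l := by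
  rw [sumOdd_eq, sumEven_eq, List.length_cons, Finset.sum_range_succ']
  simp [Nat.even_add_one, -Nat.not_even_iff_odd]

theorem sumOdd_nil : sumOdd [] = 0 := rfl

theorem sumEven_nil : sumEven [] = 0 := rfl

/-- Both formulas are proved together because prepending an element exchanges the two sums. -/
theorem sumOdd_append_and_sumEven_append (l l' : List ℕ) :
    sumOdd (l ++ l') = sumOdd l + (if Even l.length then sumOdd l' else sumEven l') ∧
    sumEven (l ++ l') = sumEven l + (if Even l.length then sumEven l' else sumOdd l') := by
  induction l with
  | nil => simp [sumOdd_nil, sumEven_nil]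
  | cons a l ih =>
    simp only [List.cons_append, sumOdd_cons, sumEven_cons, ih, List.length_cons,
      Nat.even_add_one, ite_not, add_assoc, and_self]

theorem sumOdd_append (l l' : List ℕ) :
    sumOdd (l ++ l') = sumOdd l + if Even l.length then sumOdd l' else sumEven l' :=
  (sumOdd_append_and_sumEven_append l l').1

theorem sumEven_append (l l' : List ℕ) :
    sumEven (l ++ l') = sumEven l + if Even l.length then sumEven l' else sumOdd l' :=
  (sumOdd_append_and_sumEven_append l l').2

theorem sumOdd_eq_sumEven_append_self {l : List ℕ} (h : Odd l.length) :
    sumOdd (l ++ l) = sumEven (l ++ l) := by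
  rw [sumOdd_append, sumEven_append, if_neg (Nat.not_even_iff_odd.2 h),
    if_neg (Nat.not_even_iff_odd.2 h), add_comm]

/-- Reversing a list of even length exchanges odd and even positions. -/
theorem sumOdd_reverse {l : List ℕ} (h : Even l.length) : sumOdd l.reverse = sumEven l := by
  rw [sumOdd_eq, sumEven_eq, List.length_reverse, ← Finset.sum_range_reflect]
  refine Finset.sum_congr rfl fun i hi => ?_
  have hi := Finset.mem_range.1 hi
  have : Even (l.length - 1 - i) ↔ ¬ Even i := by
    obtain ⟨c, hc⟩ := h
    simp only [Nat.even_iff]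
    omega
  simp only [this, ite_not]
  congr 1
  rw [List.getD_eq_getElem?_getD, List.getD_eq_getElem?_getD, List.getElem?_reverse (by omega)]
  congr 2
  omega

/-- The total length being even, the two pieces exchanged by a rotation have lengths of the same
parity, so the pair of sums is kept or swapped. -/
theorem sumOdd_eq_sumEven_of_isRotated {l l' : List ℕ} (hr : l'.IsRotated l) (he : Even l.length)
    (h : sumOdd l' = sumEven l') : sumOdd l = sumEven l := by
  obtain ⟨n, rfl⟩ := hr
  rw [List.length_rotate] at he
  rw [List.rotate_eq_drop_append_take_mod]
  have hlen := congrArg List.length (List.take_append_drop (n % l'.length) l')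
  rw [List.length_append] at hlen
  rw [← List.take_append_drop (n % l'.length) l', sumOdd_append, sumEven_append] at h
  rw [sumOdd_append, sumEven_append]
  have hpar : Even (l'.drop (n % l'.length)).length ↔ Even (l'.take (n % l'.length)).length := by
    rw [← hlen, Nat.even_add] at he
    exact he.symm
  simp only [hpar]
  split_ifs at h ⊢ <;> omega

theorem sumOdd_eq_sumEven_of_palindrome {l : List ℕ} (he : Even l.length)
    (h : IsCyclicPalindrome l) : sumOdd l = sumEven l := by
  obtain ⟨l', hr, hp⟩ := h
  refine sumOdd_eq_sumEven_of_isRotated hr he ?_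
  rw [← sumOdd_reverse (hr.perm.length_eq ▸ he), hp]

/-! ### The doubled period -/

theorem length_evenPeriod (l : List ℕ) :
    (evenPeriod l).length = if Odd l.length then 2 * l.length else l.length := by
  rw [evenPeriod]
  split_ifs
  · rw [List.length_append, two_mul]
  · rfl

theorem even_length_evenPeriod (l : List ℕ) : Even (evenPeriod l).length := by
  rw [length_evenPeriod]
  split_ifs with h
  · exact even_two_mul _
  · exact Nat.not_odd_iff_even.1 h

/-- This is the minimality of Π: an even multiple of an odd length is a multiple of its double. -/
theorem length_evenPeriod_dvd {l : List ℕ} {q : ℕ} (hq : Even q) (h : l.length ∣ q) :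
    (evenPeriod l).length ∣ q := by
  rw [length_evenPeriod]
  split_ifs with ho
  · exact (Nat.coprime_two_left.2 ho).mul_dvd_of_dvd_of_dvd hq.two_dvd h
  · exact h

theorem length_dvd_length_evenPeriod (l : List ℕ) : l.length ∣ (evenPeriod l).length := by
  rw [length_evenPeriod]
  split_ifs
  · exact dvd_mul_left _ _
  · exact dvd_rfl

theorem getD_evenPeriod {l : List ℕ} {i : ℕ} (hi : i < (evenPeriod l).length) :
    (evenPeriod l).getD i 0 = l.getD (i % l.length) 0 := by
  rw [length_evenPeriod] at hi
  rw [evenPeriod]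
  split_ifs at hi ⊢ with h
  · rcases lt_or_ge i l.length with hl | hl
    · rw [Nat.mod_eq_of_lt hl, List.getD_append _ _ _ _ hl]
    · rw [List.getD_append_right _ _ _ _ hl, Nat.mod_eq_sub_mod hl, Nat.mod_eq_of_lt (by omega)]
  · rw [Nat.mod_eq_of_lt hi]

/-! ### Repetitions and primitive lists -/

theorem flatten_replicate_getElem? {b : List ℕ} {r i : ℕ} (hi : i < r * b.length) :
    (List.replicate r b).flatten[i]? = b[i % b.length]? := by
  induction r generalizing i with
  | zero => omega
  | succ r ih =>
    rw [List.replicate_succ, List.flatten_cons]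
    rcases lt_or_ge i b.length with hl | hl
    · rw [List.getElem?_append_left hl, Nat.mod_eq_of_lt hl]
    · rw [List.getElem?_append_right hl, ih (by rw [Nat.succ_mul] at hi; omega),
        ← Nat.mod_eq_sub_mod hl]

theorem eq_flatten_replicate {l : List ℕ} {d r : ℕ} (hl : l.length = r * d) (hd : d ≤ l.length)
    (h : ∀ i < l.length, l[i]? = l[i % d]?) : l = (List.replicate r (l.take d)).flatten := by
  have hlen : (l.take d).length = d := List.length_take_of_le hd
  apply List.ext_getElem?
  intro i
  rcases lt_or_ge i l.length with hi | hi
  · rw [flatten_replicate_getElem? (by rw [hlen, ← hl]; exact hi), hlen, h i hi]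
    have hd0 : 0 < d := by
      rcases Nat.eq_zero_or_pos d with rfl | h0
      · omega
      · exact h0
    rw [List.getElem?_take_of_lt (Nat.mod_lt i hd0)]
  · rw [List.getElem?_eq_none hi, List.getElem?_eq_none]
    rw [List.length_flatten, List.map_replicate, List.sum_replicate, hlen, smul_eq_mul, ← hl]
    exact hi

/-- A period of the repetition of a primitive list is a multiple of its length. -/
theorem IsPrimitiveList.length_dvd {l : List ℕ} (hl : l ≠ []) (hp : IsPrimitiveList l) {q : ℕ}
    (h : ∀ j, l[(j + q) % l.length]? = l[j % l.length]?) : l.length ∣ q := by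
  have hpos : 0 < l.length := List.length_pos_iff.2 hl
  by_contra hnd
  -- By Bézout modulo the length, d is also a period. If d is a proper divisor, the list is a
  -- repetition of its prefix of length d.
  set d := Nat.gcd q l.length with hd
  have hdl : d ∣ l.length := Nat.gcd_dvd_right _ _
  have hd0 : 0 < d := Nat.gcd_pos_of_pos_right _ hpos
  have hlt : d < l.length := lt_of_le_of_ne (Nat.le_of_dvd hpos hdl) fun he =>
    hnd (Nat.gcd_eq_right_iff_dvd.1 he)
  have hmul : ∀ c j, l[(j + c * q) % l.length]? = l[j % l.length]? := by
    intro c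
    induction c with
    | zero => simp
    | succ c ih =>
      intro j
      rw [Nat.succ_mul, ← add_assoc, h, ih]
  obtain ⟨c, hc⟩ : ∃ c, c * q % l.length = d := by
    obtain ⟨c, hc⟩ := Nat.exists_mul_mod_eq_gcd (show d < l.length from hlt)
    exact ⟨c, by rw [mul_comm]; exact hc.2⟩
  have hdper : ∀ j, l[(j + d) % l.length]? = l[j % l.length]? := by
    intro j
    rw [← hmul c j, Nat.add_mod j (c * q), hc, Nat.add_mod j d, Nat.mod_eq_of_lt hlt]
  have hred : ∀ c j, l[(j + c * d) % l.length]? = l[j % l.length]? := by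
    intro c
    induction c with
    | zero => simp
    | succ c ih =>
      intro j
      rw [Nat.succ_mul, ← add_assoc, hdper, ih]
  obtain ⟨r, hr⟩ := hdl
  refine hp ⟨l.take d, r, ?_, eq_flatten_replicate (by rw [hr, mul_comm]) hlt.le fun i hi => ?_⟩
  · rcases r with _ | _ | r <;> omega
  · have := hred (i / d) (i % d)
    rw [Nat.mod_add_div' i d, Nat.mod_eq_of_lt hi,
      Nat.mod_eq_of_lt ((Nat.mod_lt i hd0).trans hlt)] at this
    exact this

theorem isPeriodOf_iff {l : List ℕ} {x : ℝ} (hx : Irrational x) (h0 : 0 < x) :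
    IsPeriodOf l x ↔ l ≠ [] ∧ IsPrimitiveList l ∧
      ∃ N, ∀ j, some (partQuot x (N + j)) = l[j % l.length]? := by
  unfold IsPeriodOf
  refine and_congr_right fun hl => and_congr_right fun _ => exists_congr fun N =>
    forall_congr' fun j => ?_
  have hj : j % l.length < l.length := Nat.mod_lt _ (List.length_pos_iff.2 hl)
  rw [abs_of_pos h0, cfElem_eq_partQuot hx h0, List.getElem?_eq_getElem hj]
  simp

/-- A recurrence among the complete quotients of an irrational number gives a period. -/
theorem exists_isPeriodOf_of_complQuot_eq {x : ℝ} (hx : Irrational x) (h0 : 0 < x) {M N : ℕ}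
    (hMN : N < M) (h : complQuot x M = complQuot x N) : ∃ l, IsPeriodOf l x := by
  have hex : ∃ p, 0 < p ∧ ∀ j, partQuot x (N + (j + p)) = partQuot x (N + j) := by
    refine ⟨M - N, by omega, fun j => ?_⟩
    rw [← partQuot_add_of_complQuot_eq h j, show N + (j + (M - N)) = M + j by omega]
  classical
  obtain ⟨p, ⟨hp0, hp⟩, hmin⟩ : ∃ p, (0 < p ∧
      ∀ j, partQuot x (N + (j + p)) = partQuot x (N + j)) ∧ ∀ q < p, ¬ (0 < q ∧
      ∀ j, partQuot x (N + (j + q)) = partQuot x (N + j)) :=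
    ⟨Nat.find hex, Nat.find_spec hex, fun q hq => Nat.find_min hex hq⟩
  set l := (List.range p).map fun j => partQuot x (N + j) with hl
  have hlen : l.length = p := by simp [hl]
  have hmod : ∀ j, partQuot x (N + j % p) = partQuot x (N + j) := fun j =>
    Function.Periodic.map_mod_nat (f := fun j => partQuot x (N + j)) hp j
  have hlj : ∀ j, some (partQuot x (N + j)) = l[j % l.length]? := by
    intro j
    rw [hlen, hl, List.getElem?_map, List.getElem?_range (Nat.mod_lt j hp0), Option.map_some, hmod]
  refine ⟨l, (isPeriodOf_iff hx h0).2 ⟨?_, ?_, N, hlj⟩⟩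
  · intro h
    rw [h] at hlen
    simp at hlen
    omega
  · rintro ⟨b, r, hr, hb⟩
    have hrb : r * b.length = p := by
      rw [← hlen, hb]
      simp
    have hb0 : 0 < b.length := by
      rcases Nat.eq_zero_or_pos b.length with h | h
      · rw [h] at hrb; omega
      · exact h
    refine hmin b.length ?_ ⟨hb0, fun j => ?_⟩
    · nlinarith
    · have key : ∀ j, some (partQuot x (N + j)) = b[j % b.length]? := by
        intro j
        rw [hlj, hb, flatten_replicate_getElem?, ← hb, hlen, ← hrb, Nat.mod_mul_left_mod]
        rw [← hb, hlen, hrb]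
        exact Nat.mod_lt _ hp0
      apply Option.some_injective
      rw [key, key, Nat.add_mod_right]

namespace BinForm

/-! ### Roots of forms -/

section Roots

variable {f g : BinForm ℤ}

theorem m_ne_zero (hsq : ¬ IsSquare f.disc) : f.m ≠ 0 := fun h =>
  hsq ⟨f.k, by simp only [disc, h]; ring⟩

theorem n_ne_zero (hsq : ¬ IsSquare f.disc) : f.n ≠ 0 := fun h =>
  hsq ⟨f.k, by simp only [disc, h]; ring⟩

theorem m_add_n_add_k_ne_zero (hsq : ¬ IsSquare f.disc) : f.m + f.n + f.k ≠ 0 := by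
  rw [← disc_act matA f] at hsq
  have := n_ne_zero hsq
  rwa [act_matA] at this

theorem irrational_sqrt_disc (hpos : 0 < f.disc) (hsq : ¬ IsSquare f.disc) :
    Irrational √(f.disc : ℝ) :=
  (irrational_sqrt_intCast_iff_of_nonneg hpos.le).2 hsq

theorem sq_sqrt_disc (hpos : 0 < f.disc) :
    √(f.disc : ℝ) ^ 2 = (f.k : ℝ) ^ 2 - 4 * f.m * f.n := by
  rw [Real.sq_sqrt (by exact_mod_cast hpos.le), disc]
  push_cast
  ring

theorem irrational_xiPlus (hpos : 0 < f.disc) (hsq : ¬ IsSquare f.disc) :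
    Irrational f.xiPlus := by
  have hm := m_ne_zero hsq
  have h := ((irrational_sqrt_disc hpos hsq).intCast_add (-f.k)).div_intCast
    (m := 2 * f.m) (by omega)
  rw [xiPlus]
  push_cast at h
  exact h

/-- A form of given nonsquare discriminant is determined by its first root. -/
theorem eq_of_xiPlus_eq (hpos : 0 < f.disc) (hsq : ¬ IsSquare f.disc) (hd : g.disc = f.disc)
    (h : g.xiPlus = f.xiPlus) : g = f := by
  have hm : (f.m : ℝ) ≠ 0 := by exact_mod_cast m_ne_zero hsq
  have hm' : (g.m : ℝ) ≠ 0 := by exact_mod_cast m_ne_zero (hd ▸ hsq)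
  rw [xiPlus, xiPlus, hd, div_eq_div_iff (by simpa using hm') (by simpa using hm)] at h
  have h1 : ((f.m - g.m : ℤ) : ℝ) * √(f.disc : ℝ) = ((f.m * g.k - g.m * f.k : ℤ) : ℝ) := by
    push_cast
    linarith
  -- Otherwise a nonzero integer multiple of the irrational √Δ would be an integer.
  have hmm : f.m - g.m = 0 := by
    by_contra hne
    exact ((irrational_sqrt_disc hpos hsq).intCast_mul hne).ne_int _ h1
  rw [hmm, Int.cast_zero, zero_mul] at h1
  have h2 : f.m * g.k - g.m * f.k = 0 := by exact_mod_cast h1.symm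
  have hmm' : g.m = f.m := by omega
  have hkk : g.k = f.k := by
    rw [hmm', ← mul_sub] at h2
    rcases mul_eq_zero.1 h2 with h3 | h3
    · exact absurd h3 (m_ne_zero hsq)
    · omega
  have hnn : g.n = f.n := by
    simp only [disc, hmm', hkk] at hd
    have h3 : 4 * f.m * (g.n - f.n) = 0 := by linarith
    rcases mul_eq_zero.1 h3 with h4 | h4
    · exact absurd (by omega) (m_ne_zero hsq)
    · omega
  ext <;> assumption

theorem xiPlus_act_matA (hsq : ¬ IsSquare f.disc) : (f.act matA).xiPlus = f.xiPlus - 1 := by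
  have hm : (f.m : ℝ) ≠ 0 := by exact_mod_cast m_ne_zero hsq
  rw [xiPlus, disc_act, act_matA, xiPlus]
  push_cast
  field_simp
  ring

theorem xiPlus_act_matB (hpos : 0 < f.disc) (hsq : ¬ IsSquare f.disc) :
    (f.act matB).xiPlus = f.xiPlus / (1 - f.xiPlus) := by
  have hm : (f.m : ℝ) ≠ 0 := by exact_mod_cast m_ne_zero hsq
  have hmnk : (f.m : ℝ) + f.n + f.k ≠ 0 := by exact_mod_cast m_add_n_add_k_ne_zero hsq
  have h1 : 1 - f.xiPlus ≠ 0 := fun h =>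
    (irrational_xiPlus hpos hsq).ne_one (by linarith)
  have hs := sq_sqrt_disc hpos
  have hx : f.xiPlus * (2 * f.m) = -f.k + √(f.disc : ℝ) := by
    rw [xiPlus]
    field_simp
  rw [xiPlus, disc_act, act_matB, div_eq_div_iff (by push_cast; simpa using hmnk) h1]
  push_cast
  have hs' : √(f.disc : ℝ) = f.xiPlus * (2 * f.m) + f.k := by linarith
  rw [hs'] at hs ⊢
  -- Squaring the expression of √Δ through ξ⁺ shows that ξ⁺ is a root of m x² + k x + n.
  have hs2 : (4 * f.m : ℝ) * (f.m * f.xiPlus ^ 2 + f.k * f.xiPlus + f.n) = 0 := by linarith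
  have hs3 : (f.m * f.xiPlus ^ 2 + f.k * f.xiPlus + f.n : ℝ) = 0 :=
    (mul_eq_zero.1 hs2).resolve_left (by simpa using hm)
  linear_combination (-2 : ℝ) * hs3

/-- The form lies in the domain `H⁰`. -/
def IsReduced (f : BinForm ℤ) : Prop := 0 < f.m ∧ f.n < 0

theorem IsReduced.disc_pos (hf : f.IsReduced) : 0 < f.disc := by
  have := mul_pos hf.1 (neg_pos.2 hf.2)
  have := sq_nonneg f.k
  rw [disc]
  linarith

/-- ξ⁺ is the larger root if m > 0 and the smaller one if m < 0. When it is positive and the form is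
not reduced, both roots are positive. -/
theorem coeff_signs_of_not_isReduced (hpos : 0 < f.disc) (hsq : ¬ IsSquare f.disc)
    (h : 0 < f.xiPlus) (hf : ¬ f.IsReduced) :
    (0 < f.m ∧ 0 < f.n ∧ f.k < 0) ∨ (f.m < 0 ∧ f.n < 0 ∧ 0 < f.k) := by
  have hs := sq_sqrt_disc hpos
  have hs0 := Real.sqrt_nonneg (f.disc : ℝ)
  have hx : f.xiPlus * (2 * f.m) = -f.k + √(f.disc : ℝ) := by
    have hm : (f.m : ℝ) ≠ 0 := by exact_mod_cast m_ne_zero hsq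
    rw [xiPlus]
    field_simp
  rcases lt_or_gt_of_ne (m_ne_zero hsq) with hm | hm
  · have hm' : (f.m : ℝ) < 0 := by exact_mod_cast hm
    have h1 : f.xiPlus * (2 * f.m) < 0 := mul_neg_of_pos_of_neg h (by linarith)
    have hk : √(f.disc : ℝ) < f.k := by linarith
    have hn : 0 < (f.m : ℝ) * f.n := by nlinarith
    have hn' : (f.n : ℝ) < 0 := by nlinarith
    exact Or.inr ⟨hm, by exact_mod_cast hn', by exact_mod_cast hs0.trans_lt hk⟩
  · have hm' : (0 : ℝ) < f.m := by exact_mod_cast hm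
    have hn : 0 < f.n := by
      rcases lt_or_gt_of_ne (n_ne_zero hsq) with hn | hn
      · exact absurd ⟨hm, hn⟩ hf
      · exact hn
    have hn' : (0 : ℝ) < f.n := by exact_mod_cast hn
    have h1 : 0 < f.xiPlus * (2 * f.m) := by positivity
    have hk : (f.k : ℝ) < √(f.disc : ℝ) := by linarith
    refine Or.inl ⟨hm, hn, ?_⟩
    by_contra hk0
    have hk0' : (0 : ℝ) ≤ f.k := by exact_mod_cast not_lt.1 hk0
    have := mul_pos hm' hn'
    nlinarith

/-- For a reduced form, f(x, 1) with x > 0 is negative exactly below ξ⁺; take x = 1. In the proof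
this is the comparison of (k + 2m)² with Δ, whose difference is 4m(m + n + k). -/
theorem IsReduced.one_lt_xiPlus_iff (hf : f.IsReduced) (hsq : ¬ IsSquare f.disc) :
    1 < f.xiPlus ↔ f.m + f.n + f.k < 0 := by
  have hm : (0 : ℝ) < f.m := by exact_mod_cast hf.1
  have hn : (f.n : ℝ) < 0 := by exact_mod_cast hf.2
  have hs := sq_sqrt_disc hf.disc_pos
  have hs0 := Real.sqrt_nonneg (f.disc : ℝ)
  rw [xiPlus, lt_div_iff₀ (by linarith), one_mul]
  rcases lt_or_gt_of_ne (m_add_n_add_k_ne_zero hsq) with h | h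
  · refine iff_of_true ?_ h
    have h' : (f.m : ℝ) + f.n + f.k < 0 := by exact_mod_cast h
    have : |(f.k : ℝ) + 2 * f.m| < √(f.disc : ℝ) :=
      abs_lt_of_sq_lt_sq (by nlinarith) hs0
    linarith [(abs_lt.1 this).2]
  · refine iff_of_false ?_ h.le.not_gt
    have h' : 0 < (f.m : ℝ) + f.n + f.k := by exact_mod_cast h
    have : |√(f.disc : ℝ)| < f.k + 2 * f.m :=
      abs_lt_of_sq_lt_sq (by nlinarith) (by linarith)
    linarith [(abs_lt.1 this).2]

end Roots

/-! ### The reduction step -/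

open Classical in
/-- One step of the subtractive reduction of a form with a positive first root. -/
noncomputable def step (f : BinForm ℤ) : BinForm ℤ :=
  if 1 < f.xiPlus then f.act matA else f.act matB

section Step

variable {f g h : BinForm ℤ}

theorem step_mem_cls (hg : g ∈ f.cls) : g.step ∈ f.cls := by
  rw [step]
  split_ifs <;> exact act_mem_cls _ hg

theorem iterate_step_mem_cls (hg : g ∈ f.cls) (i : ℕ) : step^[i] g ∈ f.cls := by
  induction i with
  | zero => exact hg
  | succ i ih =>
    rw [Function.iterate_succ_apply']
    exact step_mem_cls ih

theorem disc_iterate_step (f : BinForm ℤ) (i : ℕ) : (step^[i] f).disc = f.disc :=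
  disc_of_mem_cls (iterate_step_mem_cls (mem_cls_self f) i)

theorem xiPlus_step (hpos : 0 < f.disc) (hsq : ¬ IsSquare f.disc) :
    f.step.xiPlus = subtractiveStep f.xiPlus := by
  rw [step, subtractiveStep]
  split_ifs
  · exact xiPlus_act_matA hsq
  · exact xiPlus_act_matB hpos hsq

theorem xiPlus_iterate_step (hpos : 0 < f.disc) (hsq : ¬ IsSquare f.disc) (i : ℕ) :
    (step^[i] f).xiPlus = subtractiveStep^[i] f.xiPlus := by
  induction i with
  | zero => rfl
  | succ i ih =>
    rw [Function.iterate_succ_apply', Function.iterate_succ_apply', ← ih]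
    apply xiPlus_step <;> rwa [disc_iterate_step]

theorem xiPlus_step_pos (hpos : 0 < f.disc) (hsq : ¬ IsSquare f.disc) (h : 0 < f.xiPlus) :
    0 < f.step.xiPlus := by
  have h1 := (irrational_xiPlus hpos hsq).ne_one
  rw [xiPlus_step hpos hsq, subtractiveStep]
  split_ifs with h2
  · linarith
  · have h3 : f.xiPlus < 1 := lt_of_le_of_ne (not_lt.1 h2) h1
    exact div_pos h (by linarith)

theorem IsReduced.step_eq (hf : f.IsReduced) (hsq : ¬ IsSquare f.disc) :
    (f.m + f.n + f.k < 0 ∧ f.step = f.act matA) ∨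
      (0 < f.m + f.n + f.k ∧ f.step = f.act matB) := by
  have h0 := m_add_n_add_k_ne_zero hsq
  rw [step]
  split_ifs with h
  · exact Or.inl ⟨(hf.one_lt_xiPlus_iff hsq).1 h, rfl⟩
  · rw [hf.one_lt_xiPlus_iff hsq] at h
    exact Or.inr ⟨by omega, rfl⟩

theorem IsReduced.step (hf : f.IsReduced) (hsq : ¬ IsSquare f.disc) : f.step.IsReduced := by
  rcases hf.step_eq hsq with ⟨h, hs⟩ | ⟨h, hs⟩
  · rw [hs, act_matA]
    exact ⟨hf.1, h⟩
  · rw [hs, act_matB]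
    exact ⟨h, hf.2⟩

theorem IsReduced.iterate_step (hf : f.IsReduced) (hsq : ¬ IsSquare f.disc) (i : ℕ) :
    (BinForm.step^[i] f).IsReduced := by
  induction i with
  | zero => exact hf
  | succ i ih =>
    rw [Function.iterate_succ_apply']
    exact ih.step (by rwa [disc_iterate_step])

/-- The sign of m + n + k is that of n after step A and of m after step B. An A-image and a B-image
could only coincide if m(f) equalled m(g) + n(g) + k(g) and likewise for the other coefficients,
which the signs exclude. -/
theorem step_injOn_isReduced (hf : f.IsReduced) (hg : g.IsReduced) (hsq : ¬ IsSquare f.disc)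
    (hsq' : ¬ IsSquare g.disc) (h : f.step = g.step) : f = g := by
  obtain ⟨hf1, hf2⟩ := hf
  obtain ⟨hg1, hg2⟩ := hg
  rcases IsReduced.step_eq ⟨hf1, hf2⟩ hsq with ⟨h1, hs⟩ | ⟨h1, hs⟩ <;>
    rcases IsReduced.step_eq ⟨hg1, hg2⟩ hsq' with ⟨h2, hs'⟩ | ⟨h2, hs'⟩ <;> rw [hs, hs'] at h
  · exact act_injective _ h
  · rw [act_matA, act_matB, mk.injEq] at h
    omega
  · rw [act_matA, act_matB, mk.injEq] at h
    omega
  · exact act_injective _ h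

theorem iterate_step_injOn_isReduced (hf : f.IsReduced) (hg : g.IsReduced)
    (hsq : ¬ IsSquare f.disc) (hsq' : ¬ IsSquare g.disc) (i : ℕ)
    (h : BinForm.step^[i] f = BinForm.step^[i] g) : f = g := by
  induction i with
  | zero => exact h
  | succ i ih =>
    rw [Function.iterate_succ_apply', Function.iterate_succ_apply'] at h
    exact ih (step_injOn_isReduced (hf.iterate_step hsq i) (hg.iterate_step hsq' i)
      (by rwa [disc_iterate_step]) (by rwa [disc_iterate_step]) h)

/-- The reduction of a form with a positive first root reaches the domain `H⁰`. -/
theorem exists_iterate_step_isReduced (hpos : 0 < f.disc) (hsq : ¬ IsSquare f.disc)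
    (h : 0 < f.xiPlus) : ∃ i, (BinForm.step^[i] f).IsReduced := by
  induction hk : f.k.natAbs using Nat.strong_induction_on generalizing f with
  | _ K ih =>
    by_cases hf : f.IsReduced
    · exact ⟨0, hf⟩
    by_cases hf' : f.step.IsReduced
    · exact ⟨1, hf'⟩
    have hd : f.step.disc = f.disc := disc_iterate_step f 1
    have hpos' : 0 < f.step.disc := hd ▸ hpos
    have hsq' : ¬ IsSquare f.step.disc := hd ▸ hsq
    have hx := xiPlus_step_pos hpos hsq h
    have h1 := coeff_signs_of_not_isReduced hpos hsq h hf
    have h2 := coeff_signs_of_not_isReduced hpos' hsq' hx hf'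
    -- Both forms have k of sign opposite to m and n. Step A keeps m and adds 2m to k, step B keeps
    -- n and adds 2n, so k moves towards 0 without changing sign.
    have hlt : f.step.k.natAbs < K := by
      rw [← hk]
      have : f.step = f.act matA ∨ f.step = f.act matB := by
        rw [BinForm.step]
        split_ifs <;> simp
      rcases this with hs | hs
      · rw [hs, act_matA] at h2 ⊢
        simp only at h2 ⊢
        omega
      · rw [hs, act_matB] at h2 ⊢
        simp only at h2 ⊢
        omega
    obtain ⟨i, hi⟩ := ih _ hlt hpos' hsq' hx rfl
    exact ⟨i + 1, hi⟩

end Step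

end BinForm

namespace BinForm

/-! ### Reduced forms of one class lie on one cycle -/

theorem act_neg {R : Type*} [CommRing R] (M : Matrix.SpecialLinearGroup (Fin 2) ℤ)
    (f : BinForm R) : f.act (-M) = f.act M := by
  ext <;> simp [act]

/-- If ad < 0 then bc = ad - 1 < 0 too, and the two sides of the identity `hid` have strictly
opposite signs. -/
theorem diagonal_mul_nonneg {m n k a b c d : ℤ} (hm : 0 < m) (hn : n < 0)
    (hdet : a * d - b * c = 1) (h1 : 0 < m * a ^ 2 + n * c ^ 2 + k * a * c)
    (h2 : m * b ^ 2 + n * d ^ 2 + k * b * d < 0) : 0 ≤ a * d := by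
  by_contra had
  have had : a * d < 0 := not_le.1 had
  have hbc : b * c < 0 := by omega
  have hid : (m * a ^ 2 + n * c ^ 2 + k * a * c) * (b * d) -
      (m * b ^ 2 + n * d ^ 2 + k * b * d) * (a * c) = m * (a * b) - n * (c * d) := by
    linear_combination (m * (a * b) - n * (c * d)) * hdet
  rcases mul_neg_iff.1 had with ⟨ha, hd⟩ | ⟨ha, hd⟩ <;>
    rcases mul_neg_iff.1 hbc with ⟨hb, hc⟩ | ⟨hb, hc⟩
  · have e1 := mul_pos hm (mul_pos ha hb)
    have e2 := mul_neg_of_neg_of_pos hn (mul_pos_of_neg_of_neg hc hd)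
    have e3 := mul_neg_of_pos_of_neg h1 (mul_neg_of_pos_of_neg hb hd)
    have e4 := mul_pos_of_neg_of_neg h2 (mul_neg_of_pos_of_neg ha hc)
    linarith
  · have e1 := mul_neg_of_pos_of_neg hm (mul_neg_of_pos_of_neg ha hb)
    have e2 := mul_pos_of_neg_of_neg hn (mul_neg_of_pos_of_neg hc hd)
    have e3 := mul_pos h1 (mul_pos_of_neg_of_neg hb hd)
    have e4 := mul_neg_of_neg_of_pos h2 (mul_pos ha hc)
    linarith
  · have e1 := mul_neg_of_pos_of_neg hm (mul_neg_of_neg_of_pos ha hb)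
    have e2 := mul_pos_of_neg_of_neg hn (mul_neg_of_neg_of_pos hc hd)
    have e3 := mul_pos h1 (mul_pos hb hd)
    have e4 := mul_neg_of_neg_of_pos h2 (mul_pos_of_neg_of_neg ha hc)
    linarith
  · have e1 := mul_pos hm (mul_pos_of_neg_of_neg ha hb)
    have e2 := mul_neg_of_neg_of_pos hn (mul_pos hc hd)
    have e3 := mul_neg_of_pos_of_neg h1 (mul_neg_of_neg_of_pos hb hd)
    have e4 := mul_pos_of_neg_of_neg h2 (mul_neg_of_neg_of_pos ha hc)
    linarith

/-- A change of variables between reduced forms, or its inverse, is nonnegative up to sign. -/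
theorem IsReduced.nonneg_or_inv_nonneg {g : BinForm ℤ}
    {M : Matrix.SpecialLinearGroup (Fin 2) ℤ} (hg : g.IsReduced) (hM : (g.act M).IsReduced) :
    (∀ i j, 0 ≤ M i j) ∨ (∀ i j, 0 ≤ (-M) i j) ∨ (∀ i j, 0 ≤ M⁻¹ i j) ∨
      (∀ i j, 0 ≤ (-M⁻¹) i j) := by
  obtain ⟨hm, hn⟩ := hg
  obtain ⟨h1, h2⟩ := hM
  simp only [act, Int.cast_id] at h1 h2
  have hdet := M.det_coe
  rw [Matrix.det_fin_two] at hdet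
  simp only [Fin.forall_fin_two, Matrix.SpecialLinearGroup.coe_neg, Matrix.neg_apply,
    Matrix.SpecialLinearGroup.coe_inv, Matrix.adjugate_fin_two, Matrix.of_apply, Matrix.cons_val',
    Matrix.cons_val_zero, Matrix.cons_val_one, Matrix.cons_val_fin_one]
  generalize M 0 0 = a at *
  generalize M 0 1 = b at *
  generalize M 1 0 = c at *
  generalize M 1 1 = d at *
  have had := diagonal_mul_nonneg hm hn hdet h1 h2
  -- Nonvanishing of a and d upgrades ad ≥ 0 to ad ≥ 1, whence bc = ad - 1 ≥ 0.
  have ha0 : a ≠ 0 := by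
    rintro rfl
    have := mul_nonpos_of_nonpos_of_nonneg hn.le (sq_nonneg c)
    linarith
  have hd0 : d ≠ 0 := by
    rintro rfl
    have := mul_nonneg hm.le (sq_nonneg b)
    linarith
  have hbc : 0 ≤ b * c := by
    have : a * d ≠ 0 := mul_ne_zero ha0 hd0
    omega
  rcases mul_nonneg_iff.1 had with ⟨ha, hd⟩ | ⟨ha, hd⟩ <;>
    rcases mul_nonneg_iff.1 hbc with ⟨hb, hc⟩ | ⟨hb, hc⟩
  · left; omega
  · right; right; left; omega
  · right; right; right; omega
  · right; left; omega

/-- For a nonnegative matrix of determinant 1 other than the identity, one row dominates the other,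
so an A or a B can be split off on the left. -/
theorem row_le_or_row_le {a b c d : ℤ} (ha : 0 ≤ a) (hb : 0 ≤ b) (hc : 0 ≤ c) (hd : 0 ≤ d)
    (hdet : a * d - b * c = 1) :
    (a = 1 ∧ b = 0 ∧ c = 0 ∧ d = 1) ∨ (c ≤ a ∧ d ≤ b) ∨ (a ≤ c ∧ b ≤ d) := by
  by_contra hcon
  push Not at hcon
  obtain ⟨h1, h2, h3⟩ := hcon
  rcases lt_or_ge a c with hac | hac
  · have hbd : d < b := h3 hac.le
    nlinarith
  · have hdb := h2 hac
    have hca : c < a := by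
      rcases hac.lt_or_eq with h | h
      · exact h
      · exact absurd (h3 h.ge) (not_lt.2 hdb.le)
    obtain ⟨x, rfl⟩ := Int.le.dest (show c + 1 ≤ a from hca)
    obtain ⟨y, rfl⟩ := Int.le.dest (show b + 1 ≤ d from hdb)
    have hx : (0 : ℤ) ≤ x := Int.natCast_nonneg x
    have hy : (0 : ℤ) ≤ y := Int.natCast_nonneg y
    have hsum : (1 + (x : ℤ)) * (1 + y) + c * (1 + y) + b * (1 + x) = 1 := by linarith
    have e1 : 0 ≤ (x : ℤ) * y := mul_nonneg hx hy
    have e2 : 0 ≤ c * y := mul_nonneg hc hy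
    have e3 : 0 ≤ b * x := mul_nonneg hb hx
    have e4 : (x : ℤ) + y + c + b + (x * y + c * y + b * x) = 0 := by linarith
    have hc0 : c = 0 := by omega
    have hb0 : b = 0 := by omega
    exact h1 (by omega) hb0 hc0 (by omega)

/-- A nonnegative change of variables between reduced forms is a sequence of reduction steps. -/
theorem IsReduced.exists_iterate_step_of_nonneg {g : BinForm ℤ}
    {M : Matrix.SpecialLinearGroup (Fin 2) ℤ} (hg : g.IsReduced) (hsq : ¬ IsSquare g.disc)
    (hM : (g.act M).IsReduced) (hpos : ∀ i j, 0 ≤ M i j) : ∃ n, BinForm.step^[n] g = g.act M := by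
  induction hS : (M 0 0 + M 0 1 + M 1 0 + M 1 1).toNat using Nat.strong_induction_on
    generalizing g M with
  | _ S ih =>
  have hdet := M.det_coe
  rw [Matrix.det_fin_two] at hdet
  have ha := hpos 0 0
  have hb := hpos 0 1
  have hc := hpos 1 0
  have hd := hpos 1 1
  have hM' := hM
  simp only [IsReduced, act, Int.cast_id] at hM'
  have hstep := hg.step_eq hsq
  have hred := hg.step hsq
  have hsq' : ¬ IsSquare g.step.disc := by rwa [show g.step.disc = _ from disc_iterate_step g 1]
  obtain ⟨hm, hn⟩ := hg
  rcases row_le_or_row_le ha hb hc hd hdet with ⟨h1, h2, h3, h4⟩ | h | h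
  · refine ⟨0, ?_⟩
    have : M = 1 := by
      ext i j
      fin_cases i <;> fin_cases j <;> simp [h1, h2, h3, h4]
    rw [this, act_one]
    rfl
  · have hs : g.step = g.act matA := by
      rcases hstep with ⟨-, h'⟩ | ⟨h', -⟩
      · exact h'
      -- With b = d + e, the new n is (m + n + k)d² + (2m + k)ed + me², which would be nonnegative
      -- if m + n + k were positive.
      · obtain ⟨e, he⟩ := Int.le.dest h.2
        have he0 : (0 : ℤ) ≤ e := Int.natCast_nonneg e
        have e1 : 0 ≤ (2 * g.m + g.k) * (e * M 1 1) :=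
          mul_nonneg (by linarith) (mul_nonneg he0 hd)
        have e2 := mul_nonneg h'.le (sq_nonneg (M 1 1))
        have e3 := mul_nonneg hm.le (sq_nonneg (e : ℤ))
        have e4 := hM'.2
        rw [← he] at e4
        linarith
    have hdet' : (M 0 0 - M 1 0) * M 1 1 - (M 0 1 - M 1 1) * M 1 0 = 1 := by linarith
    set N : Matrix.SpecialLinearGroup (Fin 2) ℤ :=
      ⟨!![M 0 0 - M 1 0, M 0 1 - M 1 1; M 1 0, M 1 1], by
        rw [Matrix.det_fin_two]; simpa using hdet'⟩ with hN
    have hMN : M = matA * N := by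
      ext i j
      rw [Matrix.SpecialLinearGroup.coe_mul]
      fin_cases i <;> fin_cases j <;> simp [hN, matA, Matrix.mul_apply, Fin.sum_univ_two]
    have hact : g.act M = g.step.act N := by rw [hs, act_act, ← hMN]
    have hlt : (N 0 0 + N 0 1 + N 1 0 + N 1 1).toNat < S := by
      have : M 1 0 ≠ 0 ∨ M 1 1 ≠ 0 := by
        by_contra hcon
        push Not at hcon
        rw [hcon.1, hcon.2] at hdet
        simp at hdet
      simp [hN]
      omega
    obtain ⟨n, hn⟩ := ih _ hlt hred hsq' (hact ▸ hM)
      (by simp [Fin.forall_fin_two, hN, h, hc, hd]) rfl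
    exact ⟨n + 1, by rw [hact, ← hn]; rfl⟩
  · have hs : g.step = g.act matB := by
      rcases hstep with ⟨h', -⟩ | ⟨-, h'⟩
      -- With c = a + e, the new m is (m + n + k)a² + (2n + k)ea + ne², which would be nonpositive
      -- if m + n + k were negative.
      · obtain ⟨e, he⟩ := Int.le.dest h.1
        have he0 : (0 : ℤ) ≤ e := Int.natCast_nonneg e
        have e1 : (2 * g.n + g.k) * (e * M 0 0) ≤ 0 :=
          mul_nonpos_of_nonpos_of_nonneg (by linarith) (mul_nonneg he0 ha)
        have e2 := mul_nonpos_of_nonpos_of_nonneg h'.le (sq_nonneg (M 0 0))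
        have e3 := mul_nonpos_of_nonpos_of_nonneg hn.le (sq_nonneg (e : ℤ))
        have e4 := hM'.1
        rw [← he] at e4
        linarith
      · exact h'
    have hdet' : M 0 0 * (M 1 1 - M 0 1) - M 0 1 * (M 1 0 - M 0 0) = 1 := by linarith
    set N : Matrix.SpecialLinearGroup (Fin 2) ℤ :=
      ⟨!![M 0 0, M 0 1; M 1 0 - M 0 0, M 1 1 - M 0 1], by
        rw [Matrix.det_fin_two]; simpa using hdet'⟩ with hN
    have hMN : M = matB * N := by
      ext i j
      rw [Matrix.SpecialLinearGroup.coe_mul]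
      fin_cases i <;> fin_cases j <;> simp [hN, matB, Matrix.mul_apply, Fin.sum_univ_two]
    have hact : g.act M = g.step.act N := by rw [hs, act_act, ← hMN]
    have hlt : (N 0 0 + N 0 1 + N 1 0 + N 1 1).toNat < S := by
      have : M 0 0 ≠ 0 ∨ M 0 1 ≠ 0 := by
        by_contra hcon
        push Not at hcon
        rw [hcon.1, hcon.2] at hdet
        simp at hdet
      simp [hN]
      omega
    obtain ⟨n, hn⟩ := ih _ hlt hred hsq' (hact ▸ hM)
      (by simp [Fin.forall_fin_two, hN, h, ha, hb]) rfl
    exact ⟨n + 1, by rw [hact, ← hn]; rfl⟩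

theorem IsReduced.exists_iterate_step {f g h : BinForm ℤ} (hsq : ¬ IsSquare f.disc)
    (hgf : g ∈ f.cls) (hhf : h ∈ f.cls) (hg : g.IsReduced) (hh : h.IsReduced) :
    (∃ n, BinForm.step^[n] g = h) ∨ ∃ n, BinForm.step^[n] h = g := by
  have hsqg : ¬ IsSquare g.disc := by rwa [disc_of_mem_cls hgf]
  have hsqh : ¬ IsSquare h.disc := by rwa [disc_of_mem_cls hhf]
  obtain ⟨M, rfl⟩ := exists_act_of_mem_cls hgf hhf
  have hinv := act_act_inv M g
  rcases hg.nonneg_or_inv_nonneg hh with hM | hM | hM | hM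
  · exact Or.inl (hg.exists_iterate_step_of_nonneg hsqg hh hM)
  · rw [← act_neg] at hh ⊢
    exact Or.inl (hg.exists_iterate_step_of_nonneg hsqg hh hM)
  · have := hh.exists_iterate_step_of_nonneg hsqh (by rwa [hinv]) hM
    rw [hinv] at this
    exact Or.inr this
  · rw [← act_neg] at hinv
    have := hh.exists_iterate_step_of_nonneg hsqh (by rwa [hinv]) hM
    rw [hinv] at this
    exact Or.inr this

/-- A reduced form lying in the class of a recurrent reduced form `g` is met in its cycle. -/
theorem IsReduced.exists_lt_iterate_step_eq {f g h : BinForm ℤ} (hsq : ¬ IsSquare f.disc)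
    (hgf : g ∈ f.cls) (hhf : h ∈ f.cls) (hg : g.IsReduced) (hh : h.IsReduced) {T : ℕ} (hT : 0 < T)
    (hper : BinForm.step^[T] g = g) : ∃ n < T, BinForm.step^[n] g = h := by
  have hsqg : ¬ IsSquare g.disc := by rwa [disc_of_mem_cls hgf]
  have hsqh : ¬ IsSquare h.disc := by rwa [disc_of_mem_cls hhf]
  have hpt : Function.IsPeriodicPt BinForm.step T g := hper
  suffices ∃ n, BinForm.step^[n] g = h by
    obtain ⟨n, hn⟩ := this
    exact ⟨n % T, Nat.mod_lt n hT, by rw [hpt.iterate_mod_apply, hn]⟩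
  rcases hg.exists_iterate_step hsq hgf hhf hh with hn | ⟨n, hn⟩
  · exact hn
  -- Going back n steps from g on its cycle amounts to T * n - n steps forward; injectivity of
  -- `step` on reduced forms identifies the result with h.
  · refine ⟨T * n - n, ?_⟩
    have hle : n ≤ T * n := Nat.le_mul_of_pos_left n hT
    apply iterate_step_injOn_isReduced (hg.iterate_step hsqg _) hh
      (by rwa [disc_iterate_step]) hsqh n
    rw [hn, ← Function.iterate_add_apply, Nat.add_sub_cancel' hle]
    exact (hpt.mul_const n)

/-- With mn < 0, Δ = k² + 4|mn| bounds all three coefficients. -/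
theorem finite_isReduced (Δ : ℤ) : {g : BinForm ℤ | g.disc = Δ ∧ g.IsReduced}.Finite := by
  refine Set.Finite.subset
    ((((Set.finite_Icc (-Δ) Δ).prod (Set.finite_Icc (-Δ) Δ)).prod (Set.finite_Icc (-Δ) Δ)).image
      fun p => (⟨p.1.1, p.1.2, p.2⟩ : BinForm ℤ)) ?_
  rintro ⟨m, n, k⟩ ⟨hd, hm, hn⟩
  simp only [disc] at hd hm hn
  have h1 : 0 ≤ (m - 1) * (-n) := mul_nonneg (by omega) (by omega)
  have h2 : 0 ≤ (-n - 1) * m := mul_nonneg (by omega) (by omega)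
  have h3 : |k| ≤ k ^ 2 := by
    rw [← sq_abs]
    rcases (abs_nonneg k).eq_or_lt with h | h
    · rw [← h]; simp
    · nlinarith
  have h4 := abs_le.1 (show |k| ≤ Δ by nlinarith)
  have h5 := sq_nonneg k
  refine ⟨((m, n), k), ⟨⟨⟨?_, ?_⟩, ⟨?_, ?_⟩⟩, ⟨h4.1, h4.2⟩⟩, rfl⟩ <;> dsimp only <;> nlinarith

end BinForm

namespace BinForm

variable {f : BinForm ℤ}

/-! ### Counting the points of a class -/

/-- The trivial condition `True` gives the shape required by `encard_isReduced_eq_sum`. -/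
theorem numPoints_H0_eq (f : BinForm ℤ) :
    f.numPoints (H0 (f.disc : ℝ)) = {h ∈ f.cls | h.IsReduced ∧ True}.encard := by
  rw [numPoints]
  congr 1
  ext g
  refine and_congr_right fun hg => ?_
  rw [toReal_mem_H0, disc_of_mem_cls hg, IsReduced]
  tauto

theorem numPoints_HA_eq (hsq : ¬ IsSquare f.disc) :
    f.numPoints (HA (f.disc : ℝ)) = {h ∈ f.cls | h.IsReduced ∧ ¬ 1 < h.xiPlus}.encard := by
  rw [numPoints, ← (act_injective matA).encard_image {h ∈ f.cls | h.IsReduced ∧ ¬ 1 < h.xiPlus}]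
  congr 1
  ext g
  constructor
  · rintro ⟨hg, hD⟩
    rw [toReal_mem_HA] at hD
    have hr : (g.act matA⁻¹).IsReduced := by
      rw [act_matA_inv]
      constructor <;> simp only <;> omega
    refine ⟨g.act matA⁻¹, ⟨act_mem_cls _ hg, hr, ?_⟩, act_inv_act _ _⟩
    rw [hr.one_lt_xiPlus_iff (by rwa [disc_act, disc_of_mem_cls hg]), act_matA_inv]
    simp only
    omega
  · rintro ⟨h, ⟨hh, hr, hx⟩, rfl⟩
    have hsq' : ¬ IsSquare h.disc := by rwa [disc_of_mem_cls hh]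
    refine ⟨act_mem_cls _ hh, ?_⟩
    rw [hr.one_lt_xiPlus_iff hsq'] at hx
    have h0 := m_add_n_add_k_ne_zero hsq'
    obtain ⟨h1, h2⟩ := hr
    rw [toReal_mem_HA, disc_act, disc_of_mem_cls hh, act_matA]
    refine ⟨rfl, ?_⟩
    simp only
    omega

theorem numPoints_HB_eq (hsq : ¬ IsSquare f.disc) :
    f.numPoints (HB (f.disc : ℝ)) = {h ∈ f.cls | h.IsReduced ∧ 1 < h.xiPlus}.encard := by
  rw [numPoints, ← (act_injective matB).encard_image {h ∈ f.cls | h.IsReduced ∧ 1 < h.xiPlus}]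
  congr 1
  ext g
  constructor
  · rintro ⟨hg, hD⟩
    rw [toReal_mem_HB] at hD
    have hr : (g.act matB⁻¹).IsReduced := by
      rw [act_matB_inv]
      constructor <;> simp only <;> omega
    refine ⟨g.act matB⁻¹, ⟨act_mem_cls _ hg, hr, ?_⟩, act_inv_act _ _⟩
    rw [hr.one_lt_xiPlus_iff (by rwa [disc_act, disc_of_mem_cls hg]), act_matB_inv]
    simp only
    omega
  · rintro ⟨h, ⟨hh, hr, hx⟩, rfl⟩
    have hsq' : ¬ IsSquare h.disc := by rwa [disc_of_mem_cls hh]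
    refine ⟨act_mem_cls _ hh, ?_⟩
    rw [hr.one_lt_xiPlus_iff hsq'] at hx
    obtain ⟨h1, h2⟩ := hr
    rw [toReal_mem_HB, disc_act, disc_of_mem_cls hh, act_matB]
    refine ⟨rfl, ?_⟩
    simp only
    omega

/-- The reduced forms of a class are counted along one cycle of the reduction. -/
theorem encard_isReduced_eq_sum (hsq : ¬ IsSquare f.disc) {s T : ℕ}
    (hr : (BinForm.step^[s] f).IsReduced) (hT : 0 < T)
    (hper : BinForm.step^[s + T] f = BinForm.step^[s] f)
    (hmin : ∀ d, 0 < d → BinForm.step^[s + d] f = BinForm.step^[s] f → T ≤ d)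
    (Q : BinForm ℤ → Prop) [DecidablePred Q] :
    {h ∈ f.cls | h.IsReduced ∧ Q h}.encard =
      ((∑ i ∈ Finset.Ico s (s + T), if Q (BinForm.step^[i] f) then 1 else 0 : ℕ) : ℕ∞) := by
  have hcls : ∀ i, BinForm.step^[i] f ∈ f.cls := iterate_step_mem_cls (mem_cls_self f)
  have hsq' : ∀ i, ¬ IsSquare (BinForm.step^[i] f).disc := fun i => by rwa [disc_iterate_step]
  have hpt : BinForm.step^[T] (BinForm.step^[s] f) = BinForm.step^[s] f := by
    rw [← Function.iterate_add_apply, add_comm, hper]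
  have hset : {h ∈ f.cls | h.IsReduced ∧ Q h} = (fun i => BinForm.step^[i] f) ''
      ((Finset.Ico s (s + T)).filter fun i => Q (BinForm.step^[i] f) : Finset ℕ) := by
    ext h
    constructor
    · rintro ⟨hh, hhr, hQ⟩
      obtain ⟨n, hn, rfl⟩ := hr.exists_lt_iterate_step_eq hsq (hcls s) hh hhr hT hpt
      rw [← Function.iterate_add_apply] at hQ ⊢
      refine ⟨n + s, ?_, rfl⟩
      simp only [Finset.coe_filter, Finset.mem_Ico, Set.mem_ofPred_eq]
      exact ⟨by omega, hQ⟩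
    · rintro ⟨i, hi, rfl⟩
      simp only [Finset.coe_filter, Finset.mem_Ico, Set.mem_ofPred_eq] at hi
      refine ⟨hcls i, ?_, hi.2⟩
      dsimp only
      rw [← Nat.sub_add_cancel hi.1.1, Function.iterate_add_apply]
      exact hr.iterate_step (hsq' s) _
  have hlt : ∀ i j, s ≤ i → i < j → j < s + T → BinForm.step^[i] f ≠ BinForm.step^[j] f := by
    intro i j hi hij hj he
    -- Pushing the coincidence forward to time s + T yields a return after j - i < T steps.
    have h1 := congrArg (BinForm.step^[s + T - i]) he
    rw [← Function.iterate_add_apply, ← Function.iterate_add_apply,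
      show s + T - i + i = s + T by omega, show s + T - i + j = (j - i) + (s + T) by omega, hper,
      Function.iterate_add_apply _ (j - i), hper, ← Function.iterate_add_apply,
      add_comm (j - i)] at h1
    have := hmin (j - i) (by omega) h1.symm
    omega
  have hinj : Set.InjOn (fun i => BinForm.step^[i] f)
      ((Finset.Ico s (s + T)).filter fun i => Q (BinForm.step^[i] f) : Finset ℕ) := by
    intro i hi j hj he
    simp only [Finset.coe_filter, Finset.mem_Ico, Set.mem_ofPred_eq] at hi hj
    rcases lt_trichotomy i j with h | h | h
    · exact absurd he (hlt i j hi.1.1 h hj.1.2)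
    · exact h
    · exact absurd he.symm (hlt j i hj.1.1 h hi.1.2)
  rw [hset, hinj.encard_image, Set.encard_coe_eq_coe_finsetCard, Finset.card_filter]

theorem exists_isPeriodOf_xiPlus (hpos : 0 < f.disc) (hsq : ¬ IsSquare f.disc)
    (hx : 0 < f.xiPlus) : ∃ l, IsPeriodOf l f.xiPlus := by
  have hirr := irrational_xiPlus hpos hsq
  obtain ⟨i₀, hi₀⟩ := exists_iterate_step_isReduced hpos hsq hx
  -- Even block indices make the root a complete quotient rather than its inverse; the offset by i₀
  -- ensures that the form is already reduced.
  have hmem : ∀ j, BinForm.step^[quotSum f.xiPlus (2 * (j + i₀ + 1))] f ∈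
      {g : BinForm ℤ | g.disc = f.disc ∧ g.IsReduced} := by
    intro j
    refine ⟨disc_iterate_step f _, ?_⟩
    have hle : i₀ ≤ quotSum f.xiPlus (2 * (j + i₀ + 1)) :=
      le_trans (by omega) (le_quotSum_succ hirr (2 * (j + i₀) + 1))
    rw [← Nat.sub_add_cancel hle, Function.iterate_add_apply]
    exact hi₀.iterate_step (by rwa [disc_iterate_step]) _
  obtain ⟨i, j, hij, he⟩ := (finite_isReduced f.disc).exists_lt_map_eq_of_forall_mem hmem
  have hxi := congrArg xiPlus he
  rw [xiPlus_iterate_step hpos hsq, xiPlus_iterate_step hpos hsq,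
    subtractiveStep_iterate_quotSum hirr hx, subtractiveStep_iterate_quotSum hirr hx,
    if_pos (even_two_mul _), if_pos (even_two_mul _)] at hxi
  exact exists_isPeriodOf_of_complQuot_eq hirr hx (by omega) hxi.symm

theorem numPoints_eq_of_xiPlus_pos (hpos : 0 < f.disc) (hsq : ¬ IsSquare f.disc)
    (hx : 0 < f.xiPlus) {l : List ℕ} (hl : IsPeriodOf l f.xiPlus) :
    f.numPoints (H0 (f.disc : ℝ)) = ((evenPeriod l).sum : ℕ∞) ∧
      ((f.numPoints (HA (f.disc : ℝ)) = (sumOdd (evenPeriod l) : ℕ∞) ∧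
          f.numPoints (HB (f.disc : ℝ)) = (sumEven (evenPeriod l) : ℕ∞)) ∨
        (f.numPoints (HA (f.disc : ℝ)) = (sumEven (evenPeriod l) : ℕ∞) ∧
          f.numPoints (HB (f.disc : ℝ)) = (sumOdd (evenPeriod l) : ℕ∞))) := by
  classical
  have hirr := irrational_xiPlus hpos hsq
  obtain ⟨i₀, hi₀⟩ := exists_iterate_step_isReduced hpos hsq hx
  obtain ⟨hne, hprim, N₀, hN₀⟩ := (isPeriodOf_iff hirr hx).1 hl
  have hL : 0 < l.length := List.length_pos_iff.2 hne
  obtain ⟨N, hN, hiN, hlN⟩ : ∃ N, 1 ≤ N ∧ i₀ ≤ quotSum f.xiPlus N ∧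
      ∀ j, some (partQuot f.xiPlus (N + j)) = l[j % l.length]? := by
    -- Moving the start by a multiple of the period length keeps it aligned with l and brings it
    -- past the preperiod of the reduction.
    have hle : i₀ + 1 ≤ l.length * (i₀ + 1) := Nat.le_mul_of_pos_left _ hL
    refine ⟨N₀ + l.length * (i₀ + 1), by omega, ?_, fun j => ?_⟩
    · exact (le_quotSum_succ hirr i₀).trans (quotSum_mono _ (by omega))
    · rw [add_assoc, hN₀, Nat.mul_add_mod]
  set x := f.xiPlus with hxdef
  set p := (evenPeriod l).length with hp
  have hpe : Even p := even_length_evenPeriod l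
  have hp0 : 0 < p := by
    rw [hp, length_evenPeriod]
    split_ifs <;> omega
  have hperiod : ∀ j, partQuot x (N + p + j) = partQuot x (N + j) := by
    intro j
    apply Option.some_injective
    obtain ⟨c, hc⟩ := length_dvd_length_evenPeriod l
    rw [add_assoc, hlN, hlN, hp, hc, Nat.mul_add_mod]
  have hget : ∀ j ∈ Finset.range p, partQuot x (N + j) = (evenPeriod l).getD j 0 := by
    intro j hj
    rw [getD_evenPeriod (Finset.mem_range.1 hj), List.getD_eq_getElem?_getD, ← hlN]
    rfl
  obtain ⟨T, hT⟩ := Nat.exists_eq_add_of_le (quotSum_mono x (Nat.le_add_right N p))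
  have hT0 : 0 < T := by
    have h1 := quotSum_lt_succ hirr hN
    have h2 := quotSum_mono x (show N + 1 ≤ N + p by omega)
    omega
  have hr : (BinForm.step^[quotSum x N] f).IsReduced := by
    rw [← Nat.sub_add_cancel hiN, Function.iterate_add_apply]
    exact hi₀.iterate_step (by rwa [disc_iterate_step]) _
  have hper : BinForm.step^[quotSum x N + T] f = BinForm.step^[quotSum x N] f := by
    apply eq_of_xiPlus_eq
    · rwa [disc_iterate_step]
    · rwa [disc_iterate_step]
    · rw [disc_iterate_step, disc_iterate_step]
    · rw [xiPlus_iterate_step hpos hsq, xiPlus_iterate_step hpos hsq, ← hT,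
        subtractiveStep_iterate_quotSum hirr hx, subtractiveStep_iterate_quotSum hirr hx,
        complQuot_eq_of_partQuot_eq hirr hx hperiod]
      simp only [Nat.even_add, hpe, iff_true]
  -- A return of forms is a return of roots, hence an even recurrence q of complete quotients. Such
  -- a q is a multiple of the length p of Π.
  have hmin : ∀ d, 0 < d →
      BinForm.step^[quotSum x N + d] f = BinForm.step^[quotSum x N] f → T ≤ d := by
    intro d hd he
    have hxi := congrArg xiPlus he
    rw [xiPlus_iterate_step hpos hsq, xiPlus_iterate_step hpos hsq] at hxi
    obtain ⟨q, hqe, hq0, hqs, hqc⟩ :=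
      exists_even_of_subtractiveStep_iterate_eq hirr hx hN hd hxi
    have hdvd : l.length ∣ q := by
      refine hprim.length_dvd hne fun j => ?_
      -- Adding one full period to the index makes room for the subtraction of 1 caused by the
      -- recurrence starting at N + 1.
      rw [← Nat.add_mod_right, ← hlN, ← Nat.add_mod_right j, ← hlN,
        show N + (j + q + l.length) = N + 1 + q + (j + l.length - 1) by omega,
        show N + (j + l.length) = N + 1 + (j + l.length - 1) by omega,
        partQuot_add_of_complQuot_eq hqc]
    have hpq : p ≤ q := Nat.le_of_dvd hq0 (length_evenPeriod_dvd hqe hdvd)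
    have h1 := quotSum_mono x (show N + p + 1 ≤ N + 1 + q by omega)
    have h2 := hperiod 0
    rw [hqs, quotSum_succ, quotSum_succ, hT] at h1
    rw [add_zero, add_zero] at h2
    omega
  have hsum : ∀ c d, (∑ i ∈ Finset.Ico (quotSum x N) (quotSum x N + T),
      if 1 < (BinForm.step^[i] f).xiPlus then c else d) =
      ∑ j ∈ Finset.range p, if Even (N + j) then c * (evenPeriod l).getD j 0
        else d * (evenPeriod l).getD j 0 := by
    intro c d
    simp only [xiPlus_iterate_step hpos hsq]
    rw [← hT, sum_Ico_quotSum hirr hx]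
    exact Finset.sum_congr rfl fun j hj => by rw [hget j hj]
  rw [numPoints_H0_eq, numPoints_HA_eq hsq, numPoints_HB_eq hsq,
    encard_isReduced_eq_sum hsq hr hT0 hper hmin (fun _ => True),
    encard_isReduced_eq_sum hsq hr hT0 hper hmin (fun h => ¬ 1 < h.xiPlus),
    encard_isReduced_eq_sum hsq hr hT0 hper hmin (fun h => 1 < h.xiPlus),
    sumOdd_eq, sumEven_eq, sum_eq_sum_getD]
  -- The weights count all steps, the steps with ξ⁺ > 1, and the remaining ones.
  have h1 := hsum 1 1
  have h2 := hsum 1 0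
  have h3 := hsum 0 1
  simp only [ite_self, one_mul, zero_mul] at h1 h2 h3
  simp only [ite_not, if_true, h1, h2, h3]
  refine ⟨rfl, ?_⟩
  -- Positions in Π are numbered from 1 and blocks from N. For even N the odd positions of Π are
  -- A-runs, which are counted by `HB`.
  by_cases hNe : Even N
  · right
    simp only [Nat.even_add, hNe, true_iff]
    exact ⟨rfl, rfl⟩
  · left
    simp only [Nat.even_add, hNe, false_iff, ite_not]
    exact ⟨rfl, rfl⟩

end BinForm

/-! ### First roots of either sign -/

theorem IsPeriodOf.neg {l : List ℕ} {x : ℝ} (h : IsPeriodOf l x) : IsPeriodOf l (-x) := by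
  rwa [IsPeriodOf, abs_neg]

namespace BinForm

theorem exists_isPeriodOf {f : BinForm ℤ} (hpos : 0 < f.disc) (hsq : ¬ IsSquare f.disc) :
    ∃ l, IsPeriodOf l f.xiPlus := by
  rcases lt_or_gt_of_ne (irrational_xiPlus hpos hsq).ne_zero with hx | hx
  · rw [← disc_negConj] at hpos hsq
    obtain ⟨l, hl⟩ := exists_isPeriodOf_xiPlus hpos hsq (by rw [xiPlus_negConj]; linarith)
    rw [xiPlus_negConj] at hl
    exact ⟨l, neg_neg f.xiPlus ▸ hl.neg⟩
  · exact exists_isPeriodOf_xiPlus hpos hsq hx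

theorem numPoints_eq {f : BinForm ℤ} (hpos : 0 < f.disc) (hsq : ¬ IsSquare f.disc)
    {l : List ℕ} (hl : IsPeriodOf l f.xiPlus) :
    f.numPoints (H0 (f.disc : ℝ)) = ((evenPeriod l).sum : ℕ∞) ∧
      ((f.numPoints (HA (f.disc : ℝ)) = (sumOdd (evenPeriod l) : ℕ∞) ∧
          f.numPoints (HB (f.disc : ℝ)) = (sumEven (evenPeriod l) : ℕ∞)) ∨
        (f.numPoints (HA (f.disc : ℝ)) = (sumEven (evenPeriod l) : ℕ∞) ∧
          f.numPoints (HB (f.disc : ℝ)) = (sumOdd (evenPeriod l) : ℕ∞))) := by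
  rcases lt_or_gt_of_ne (irrational_xiPlus hpos hsq).ne_zero with hx | hx
  · have h := numPoints_eq_of_xiPlus_pos (f := f.negConj) (by rwa [disc_negConj])
      (by rwa [disc_negConj]) (by rw [xiPlus_negConj]; linarith)
      (by rw [xiPlus_negConj]; exact hl.neg)
    rw [disc_negConj, numPoints_negConj_H0, numPoints_negConj_HA, numPoints_negConj_HB] at h
    -- Passing to `negConj` exchanged the counts of `HA` and `HB`, hence the two alternatives.
    tauto
  · exact numPoints_eq_of_xiPlus_pos hpos hsq hx hl

end BinForm

/-! ### The theorem -/

theorem half_sum_of_sumOdd_eq_sumEven {l : List ℕ} (h : sumOdd l = sumEven l) :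
    (sumOdd l : ℚ) = (l.sum : ℚ) / 2 ∧ (sumEven l : ℚ) = (l.sum : ℚ) / 2 := by
  rw [← sumOdd_add_sumEven, h]
  push_cast
  constructor <;> ring

theorem mainTheorem10 (f : BinForm ℤ) (hpos : 0 < f.disc) (hsq : ¬ IsSquare f.disc) :
    (∃ Γ : List ℕ, IsPeriodOf Γ f.xiPlus) ∧
    ∀ Γ : List ℕ, IsPeriodOf Γ f.xiPlus →
      f.numPoints (BinForm.H0 (f.disc : ℝ)) = ((evenPeriod Γ).sum : ℕ∞) ∧
      f.numPoints (BinForm.H0R (f.disc : ℝ)) = ((evenPeriod Γ).sum : ℕ∞) ∧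
      (((∀ D ∈ BinForm.GA (f.disc : ℝ) ∪ BinForm.GAbar (f.disc : ℝ),
            f.numPoints D = (sumOdd (evenPeriod Γ) : ℕ∞)) ∧
          (∀ D ∈ BinForm.GB (f.disc : ℝ) ∪ BinForm.GBbar (f.disc : ℝ),
            f.numPoints D = (sumEven (evenPeriod Γ) : ℕ∞))) ∨
        ((∀ D ∈ BinForm.GA (f.disc : ℝ) ∪ BinForm.GAbar (f.disc : ℝ),
            f.numPoints D = (sumEven (evenPeriod Γ) : ℕ∞)) ∧
          (∀ D ∈ BinForm.GB (f.disc : ℝ) ∪ BinForm.GBbar (f.disc : ℝ),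
            f.numPoints D = (sumOdd (evenPeriod Γ) : ℕ∞)))) ∧
      ((Odd Γ.length ∨ (Even Γ.length ∧ IsCyclicPalindrome Γ)) →
        (sumOdd (evenPeriod Γ) : ℚ) = ((evenPeriod Γ).sum : ℚ) / 2 ∧
        (sumEven (evenPeriod Γ) : ℚ) = ((evenPeriod Γ).sum : ℚ) / 2) ∧
      ((BinForm.IsSupersymmetric f.cls ∨ BinForm.IsAntisymmetric f.cls ∨
          BinForm.IsMNSymmetric f.cls) →
        (sumOdd (evenPeriod Γ) : ℚ) = ((evenPeriod Γ).sum : ℚ) / 2 ∧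
        (sumEven (evenPeriod Γ) : ℚ) = ((evenPeriod Γ).sum : ℚ) / 2) := by
  refine ⟨BinForm.exists_isPeriodOf hpos hsq, fun Γ hΓ => ?_⟩
  obtain ⟨h0, hAB⟩ := BinForm.numPoints_eq hpos hsq hΓ
  refine ⟨h0, by rw [BinForm.numPoints_H0R, h0], ?_, ?_, ?_⟩
  · rcases hAB with ⟨hA, hB⟩ | ⟨hA, hB⟩
    · exact Or.inl ⟨fun D hD => (BinForm.numPoints_of_mem_GA hD).trans hA,
        fun D hD => (BinForm.numPoints_of_mem_GB hD).trans hB⟩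
    · exact Or.inr ⟨fun D hD => (BinForm.numPoints_of_mem_GA hD).trans hA,
        fun D hD => (BinForm.numPoints_of_mem_GB hD).trans hB⟩
  · intro h
    apply half_sum_of_sumOdd_eq_sumEven
    rw [evenPeriod]
    rcases h with h | ⟨he, h⟩
    · rw [if_pos h]
      exact sumOdd_eq_sumEven_append_self h
    · rw [if_neg (Nat.not_odd_iff_even.2 he)]
      exact sumOdd_eq_sumEven_of_palindrome he h
  · intro h
    apply half_sum_of_sumOdd_eq_sumEven
    have hEq : f.numPoints (BinForm.HA (f.disc : ℝ)) = f.numPoints (BinForm.HB (f.disc : ℝ)) := by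
      rcases h with h | h | h
      · exact BinForm.numPoints_HA_eq_HB_of_antipodal h.2.2 _
      · exact BinForm.numPoints_HA_eq_HB_of_antipodal h.2.2 _
      · exact BinForm.numPoints_HA_eq_HB_of_adjoint h.2.1 _
    rcases hAB with ⟨hA, hB⟩ | ⟨hA, hB⟩
    · rw [hA, hB] at hEq
      exact_mod_cast hEq
    · rw [hA, hB] at hEq
      exact_mod_cast hEq.symm
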